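/- Label the vertices of a convex $n$-gon ($n\ge 3$) counterclockwise by $1,\dots,n$, with $n+1$ read as $1$ and $0$ read as $n$. A *3d-dissection* of the $n$-gon is a partition of it into sub-polygons by pairwise non-crossing diagonals such that the number of vertices of every sub-polygon is a multiple of $3$. Its *Ovsienko index* $\mathfrak i$ is the number of sub-polygons with an even number of vertices; the 3d-dissection is *even* or *odd* according to the parity of $\mathfrak i$. Its *quiddity sequence* is $(a_1,\dots,a_n)$, where $a_i$ is the number of sub-polygons having $i$ as a vertex. For integers $a_1,\dots,a_N$ put $$M(a_1,\dots,a_N)=\begin{pmatrix}a_N&-1\\1&0\end{pmatrix}\cdots\begin{pmatrix}a_1&-1\\1&0\end{pmatrix}.$$ Let $S$ be a 3d-dissection of an $n$-gon with quiddity sequence $(s_1,\dots,s_n)$ and $T$ a 3d-dissection of an $m$-gon with quiddity sequence $(t_1,\dots,t_m)$. For $1\le k\le n$ define two dissections of an $(n+m-1)$-gon, labelled starting from vertex $1$ of the $n$-gon: * $S\circ_k T$: identify vertex $k$ of the $n$-gon with vertex $1$ of the $m$-gon and join vertex $k+1$ of the $n$-gon to vertex $m$ of the $m$-gon by a new side;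 the diagonals are those of $S$ and of $T$, the side $(k,k+1)$ of the $n$-gon and the side $(m,1)$ of the $m$-gon. * $S\bullet_k T$: identify vertex $k$ of the $n$-gon with vertex $1$ of the $m$-gon and join vertex $k-1$ of the $n$-gon to vertex $2$ of the $m$-gon by a new side; the diagonals are those of $S$ and of $T$, the side $(k-1,k)$ of the $n$-gon and the side $(1,2)$ of the $m$-gon. **Theorem.** Suppose that $S$ and $T$ are both even or both odd. Then for every $k=1,\dots,n$ the following hold. 1. $S\circ_k T$ and $S\bullet_k T$ are even 3d-dissections of an $(n+m-1)$-gon, and $\mathfrak i(S\circ_kT)=\mathfrak i(S\bullet_kT)=\mathfrak i(S)+\mathfrak i(T)$. 2. The quiddity sequence of $S\circ_k T$ is $$(s_1,\dots,s_{k-1},\,s_k+t_1+1,\,t_2,\dots,t_{m-1},\,t_m+1,\,s_{k+1}+1,\,s_{k+2},\dots,s_n)$$ if $k<n$, and $(s_1+1,s_2,\dots,s_{n-1},s_n+t_1+1,t_2,\dots,t_{m-1},t_m+1)$ if $k=n$. The quiddity sequence of $S\bullet_k T$ is $$(s_1,\dots,s_{k-2},\,s_{k-1}+1,\,t_2+1,\,t_3,\dots,t_m,\,s_k+t_1+1,\,s_{k+1},\dots,s_n)$$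 if $k>1$, and $(s_1+t_1+1,s_2,\dots,s_{n-1},s_n+1,t_2+1,t_3,\dots,t_m)$ if $k=1$. 3. Both of these sequences are solutions, in positive integers, of the equation $M(a_1,\dots,a_{n+m-1})=-\mathrm{Id}$. This gives $2n$ solutions of length $n+m-1$, indexed by the two products and by $k=1,\dots,n$. The $n$ solutions coming from the products $\circ_k$ are pairwise distinct, and so are the $n$ solutions coming from the products $\bullet_k$ (a solution of the first family may coincide with one of the second). -/

import Mathlib

/-! The vertices of a convex `n`-gon are labelled counterclockwise by `1, …, n`.  A dissection is
given by the finite set of diagonals that cut the polygon, a diagonal being an unordered pair of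
labels. -/

namespace ThreeD

/-- The vertex that follows `a` in the `n`-gon; vertex `n + 1` is vertex `1`. -/
def next (n a : ℕ) : ℕ := if a = n then 1 else a + 1

/-- The vertex that precedes `a` in the `n`-gon; vertex `0` is vertex `n`. -/
def prev (n a : ℕ) : ℕ := if a = 1 then n else a - 1

/-- `a` and `b` are the endpoints of a side of the `n`-gon. -/
def IsSide (n a b : ℕ) : Prop := next n a = b ∨ next n b = a

instance (n a b : ℕ) : Decidable (IsSide n a b) := by unfold IsSide; infer_instance

/-- `D` is a set of pairwise non-crossing diagonals of a convex `n`-gon. -/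
structure IsDissection (n : ℕ) (D : Finset (Sym2 ℕ)) : Prop where
  three_le : 3 ≤ n
  diagonal : ∀ a b, s(a, b) ∈ D →
    a ∈ Finset.Icc 1 n ∧ b ∈ Finset.Icc 1 n ∧ a ≠ b ∧ ¬ IsSide n a b
  noncrossing : ∀ a b c d, a < b → b < c → c < d → ¬ (s(a, c) ∈ D ∧ s(b, d) ∈ D)

/-- `a` and `b` are neighbours in the convex polygon with vertex set `P`: one of the two open arcs
that `a` and `b` cut out of the circle contains no vertex of `P`. -/
def Consecutive (P : Finset ℕ) (a b : ℕ) : Prop :=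
  (∀ c ∈ P, ¬ (min a b < c ∧ c < max a b)) ∨ (∀ c ∈ P, min a b ≤ c ∧ c ≤ max a b)

instance (P : Finset ℕ) (a b : ℕ) : Decidable (Consecutive P a b) := by
  unfold Consecutive; infer_instance

/-- `P` is the vertex set of a sub-polygon of the dissection `D` of the `n`-gon: two vertices of `P`
are joined by a side of the `n`-gon or by a diagonal in `D` exactly when they are neighbours in `P`
(so the boundary of the polygon `P` is drawn, and no diagonal in `D` cuts it further). -/
def IsSubPolygon (n : ℕ) (D : Finset (Sym2 ℕ)) (P : Finset ℕ) : Prop :=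
  3 ≤ P.card ∧ ∀ a ∈ P, ∀ b ∈ P, a ≠ b → ((IsSide n a b ∨ s(a, b) ∈ D) ↔ Consecutive P a b)

instance (n : ℕ) (D : Finset (Sym2 ℕ)) (P : Finset ℕ) : Decidable (IsSubPolygon n D P) := by
  unfold IsSubPolygon; infer_instance

/-- The sub-polygons of the dissection `D`, each given by its set of vertices. -/
def subPolygons (n : ℕ) (D : Finset (Sym2 ℕ)) : Finset (Finset ℕ) :=
  (Finset.Icc 1 n).powerset.filter (IsSubPolygon n D)

/-- A 3d-dissection: the number of vertices of every sub-polygon is a multiple of `3`. -/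
def Is3dDissection (n : ℕ) (D : Finset (Sym2 ℕ)) : Prop :=
  IsDissection n D ∧ ∀ P ∈ subPolygons n D, 3 ∣ P.card

/-- The Ovsienko index: the number of sub-polygons with an even number of vertices. -/
def index (n : ℕ) (D : Finset (Sym2 ℕ)) : ℕ :=
  ((subPolygons n D).filter (fun P => Even P.card)).card

/-- An even 3d-dissection of the `n`-gon. -/
def IsEven3d (n : ℕ) (D : Finset (Sym2 ℕ)) : Prop := Is3dDissection n D ∧ Even (index n D)

/-- An odd 3d-dissection of the `n`-gon. -/
def IsOdd3d (n : ℕ) (D : Finset (Sym2 ℕ)) : Prop := Is3dDissection n D ∧ Odd (index n D)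

/-- The quiddity sequence `(a₁, …, aₙ)`: `aᵢ` is the number of sub-polygons at vertex `i`. -/
def quiddity (n : ℕ) (D : Finset (Sym2 ℕ)) : List ℕ :=
  (List.range' 1 n).map (fun i => ((subPolygons n D).filter (fun P => i ∈ P)).card)

/-- Relabelling of the vertices of a polygon when `m - 1` new vertices are inserted right after
vertex `j`. -/
def shift (m j i : ℕ) : ℕ := if i ≤ j then i else i + (m - 1)

/-- The product `S ∘ₖ T` of dissections of an `n`-gon and an `m`-gon: vertex `1` of the second
polygon is put on vertex `k` of the first, and vertex `m` of the second is joined to vertex `k + 1`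
of the first.  The diagonals are the old ones, the side `(k, k + 1)` of the first polygon and the
side `(m, 1)` of the second.  Labels start at vertex `1` of the first polygon; vertex `i` of the
second polygon gets the label `k + i - 1`. -/
def circ (n m k : ℕ) (S T : Finset (Sym2 ℕ)) : Finset (Sym2 ℕ) :=
  S.image (Sym2.map (shift m k)) ∪ T.image (Sym2.map (fun i => k + i - 1)) ∪
    {s(shift m k k, shift m k (next n k)), s(k, k + m - 1)}

/-- The label in `S •ₖ T` of vertex `i` of the second polygon: vertex `1` lies on vertex `k` of the
first polygon, the others follow vertex `k - 1` of the first polygon. -/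
def bulletLabel (n m k i : ℕ) : ℕ :=
  if i = 1 then shift m (prev n k) k else prev n k + i - 1

/-- The product `S •ₖ T`: vertex `1` of the second polygon is put on vertex `k` of the first, and
vertex `2` of the second is joined to vertex `k - 1` of the first.  The diagonals are the old
ones, the side `(k - 1, k)` of the first polygon and the side `(1, 2)` of the second. -/
def bullet (n m k : ℕ) (S T : Finset (Sym2 ℕ)) : Finset (Sym2 ℕ) :=
  S.image (Sym2.map (shift m (prev n k))) ∪ T.image (Sym2.map (bulletLabel n m k)) ∪
    {s(shift m (prev n k) (prev n k), shift m (prev n k) k),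
      s(bulletLabel n m k 1, bulletLabel n m k 2)}

/-- The product `s ∘ₖ t` of sequences `s = (s₁, …, sₙ)` and `t = (t₁, …, tₘ)`,
`(s₁, …, sₖ₋₁, sₖ + t₁ + 1, t₂, …, tₘ₋₁, tₘ + 1, sₖ₊₁ + 1, sₖ₊₂, …, sₙ)` for `k < n` and
`(s₁ + 1, s₂, …, sₙ₋₁, sₙ + t₁ + 1, t₂, …, tₘ₋₁, tₘ + 1)` for `k = n`.  (`List.modify` counts
positions from `0`.) -/
def circSeq (k : ℕ) (s t : List ℕ) : List ℕ :=
  let s' := (s.modify (k - 1) (· + t.headD 0 + 1)).modify (next s.length k - 1) (· + 1)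
  s'.take k ++ t.tail.modify (t.length - 2) (· + 1) ++ s'.drop k

/-- The product `s •ₖ t` of sequences `s = (s₁, …, sₙ)` and `t = (t₁, …, tₘ)`,
`(s₁, …, sₖ₋₂, sₖ₋₁ + 1, t₂ + 1, t₃, …, tₘ, sₖ + t₁ + 1, sₖ₊₁, …, sₙ)` for `k > 1` and
`(s₁ + t₁ + 1, s₂, …, sₙ₋₁, sₙ + 1, t₂ + 1, t₃, …, tₘ)` for `k = 1`. -/
def bulletSeq (k : ℕ) (s t : List ℕ) : List ℕ :=
  let j := prev s.length k
  let s' := (s.modify (k - 1) (· + t.headD 0 + 1)).modify (j - 1) (· + 1)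
  s'.take j ++ t.tail.modify 0 (· + 1) ++ s'.drop j

/-- `M(a₁, …, aₙ) = M(aₙ) ⋯ M(a₁)` with `M(a) = (a, -1; 1, 0)`. -/
def M (a : List ℤ) : Matrix (Fin 2) (Fin 2) ℤ :=
  (a.reverse.map (fun x => !![x, -1; 1, 0])).prod

/-- `a = (a₁, …, a_N)` is a solution of `M(a₁, …, a_N) = -Id` in positive integers. -/
def IsPositiveSolution (N : ℕ) (a : List ℕ) : Prop :=
  a.length = N ∧ (∀ x ∈ a, 0 < x) ∧ M (a.map (fun x => (x : ℤ))) = -1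

end ThreeD

/-! Both products are cases of one gluing. The `m`-gon is inserted into the gap between `j` and
`next n j` of the `n`-gon, sharing one vertex with it. A side of each polygon at the shared vertex
becomes a diagonal, and these two diagonals bound a triangle with the one new side that joins their
other ends. Hence the faces of the result are those of `S`, those of `T` and this triangle
(`IsGluing.faces_glue`). The triangle has three vertices, so divisibility by `3` persists and the
index is additive; counting faces vertex by vertex gives the quiddity sequence. The parity
hypothesis serves only to make the sum of the indices even.

The matrix equation holds because every 3d-dissection satisfies M(quiddity) = (-1)^(index + 1)
(`M_vertexDegree`), by induction on cuts along a diagonal. A single `3j`-gon gives M(1,1,1)^j =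
(-1)^j, and `j` has the parity of `3j`. Along a diagonal the degrees at its two ends add up; M(x+y)
= -M(x)M(0)M(y) (`step_add`) and M(0)² = -Id then show that the signs of the two pieces multiply
with one further factor -1 (`M_glue`). Positivity of the degrees follows by the same kind of cutting
(`IsPlanar.vertexDegree_pos`).

For these inductions, faces are defined for any edge relation on a finite set of integers, so that
the pieces of a cut are objects of the same kind. Everything is phrased through crossing of chords,
so faces are carried along by any relabelling that preserves crossings (`IsCyclicEmbedding`).

For distinctness, take a place that holds the same vertex `k` of the first polygon in two gluings,
only one of which is made at `k`. That one adds at least t₁ + 1 ≥ 2 to the entry, the other at most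
1 (`IsGluing.glueSeq_ne`). -/

namespace ThreeD

/-! ### Crossing chords and faces of a drawing -/

/-- The chord `cd` crosses the chord `ab`, with `c` on the inner side. -/
def Cross (a b c d : ℕ) : Prop :=
  (min a b < c ∧ c < max a b) ∧ (d < min a b ∨ max a b < d)

/-- If both arcs cut out by `a` and `b` contain vertices of `P`, one from each arc gives a crossing
chord. This form is insensitive to where the cyclic labelling starts. -/
theorem consecutive_iff {P : Finset ℕ} {a b : ℕ} :
    Consecutive P a b ↔ ∀ c ∈ P, ∀ d ∈ P, ¬ Cross a b c d := by
  constructor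
  · rintro (h | h) c hc d hd ⟨h1, h2⟩
    · exact h c hc h1
    · have := h d hd
      omega
  · intro h
    by_contra hn
    simp only [Consecutive, not_or, not_forall, not_not] at hn
    obtain ⟨⟨c, hc, h1⟩, d, hd, h2⟩ := hn
    exact h c hc d hd ⟨h1, by omega⟩

theorem consecutive_comm {P : Finset ℕ} {a b : ℕ} : Consecutive P a b ↔ Consecutive P b a := by
  simp only [Consecutive, min_comm, max_comm]

/-- `P` is the vertex set of a face of the drawing whose edges are given by `E`. -/
def IsFace (E : ℕ → ℕ → Prop) (P : Finset ℕ) : Prop :=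
  3 ≤ P.card ∧ ∀ a ∈ P, ∀ b ∈ P, a ≠ b → (E a b ↔ Consecutive P a b)

open Classical in
/-- The faces with all vertices in `V`. -/
noncomputable def faces (E : ℕ → ℕ → Prop) (V : Finset ℕ) : Finset (Finset ℕ) :=
  V.powerset.filter (IsFace E)

theorem mem_faces {E : ℕ → ℕ → Prop} {V P : Finset ℕ} : P ∈ faces E V ↔ P ⊆ V ∧ IsFace E P := by
  simp [faces]

/-- The number of faces inside `V` at the vertex `i`. -/
noncomputable def vertexDegree (E : ℕ → ℕ → Prop) (V : Finset ℕ) (i : ℕ) : ℕ :=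
  ((faces E V).filter (fun P => i ∈ P)).card

/-- The number of faces inside `V` with an even number of vertices. -/
noncomputable def evenFaces (E : ℕ → ℕ → Prop) (V : Finset ℕ) : ℕ :=
  ((faces E V).filter (fun P => Even P.card)).card

theorem vertexDegree_eq_zero {E : ℕ → ℕ → Prop} {V : Finset ℕ} {i : ℕ} (hi : i ∉ V) :
    vertexDegree E V i = 0 := by
  rw [vertexDegree, Finset.card_eq_zero, Finset.filter_eq_empty_iff]
  intro P hP hiP
  exact hi ((mem_faces.1 hP).1 hiP)

/-- A chord of the drawing that no edge of the face `P` crosses does not separate vertices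
of `P`. -/
theorem IsFace.subset_side {E : ℕ → ℕ → Prop} {P : Finset ℕ} (hP : IsFace E P) {a b : ℕ}
    (hab : a < b) (hE : E a b) (hnc : ∀ c ∈ P, ∀ d ∈ P, E c d → ¬ Cross a b c d) :
    (∀ x ∈ P, a ≤ x ∧ x ≤ b) ∨ (∀ x ∈ P, x ≤ a ∨ b ≤ x) := by
  by_contra hcon
  simp only [not_or, not_forall] at hcon
  obtain ⟨⟨d, hd, hd'⟩, c, hc, hc'⟩ := hcon
  obtain ⟨hPc, hPE⟩ := hP
  have edge : ∀ c ∈ P, ∀ d ∈ P, Consecutive P c d → ¬ Cross a b c d := by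
    intro c hc d hd h hx
    have hne : c ≠ d := by rintro rfl; unfold Cross at hx; omega
    exact hnc c hc d hd ((hPE c hc d hd hne).2 h) hx
  -- If `a` is not in `P`, the boundary edge of `P` that jumps over `a` crosses `ab`.
  have haP : a ∈ P := by
    by_contra haP
    have hne : (P.filter (fun x => a < x)).Nonempty :=
      ⟨c, Finset.mem_filter.2 ⟨hc, by omega⟩⟩
    obtain ⟨c0, hc0, hmin⟩ := (P.filter (fun x => a < x)).exists_minimal hne
    have hmin' : ∀ x ∈ P, a < x → c0 ≤ x := fun x hx hax => by
      by_contra hlt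
      exact hlt (hmin (Finset.mem_filter.2 ⟨hx, hax⟩) (by omega))
    rw [Finset.mem_filter] at hc0
    have hcc := hmin' c hc (by omega)
    by_cases hlow : (P.filter (fun x => x < a)).Nonempty
    · obtain ⟨p, hp, hmax⟩ := (P.filter (fun x => x < a)).exists_maximal hlow
      have hmax' : ∀ x ∈ P, x < a → x ≤ p := fun x hx hax => by
        by_contra hlt
        exact hlt (hmax (Finset.mem_filter.2 ⟨hx, hax⟩) (by omega))
      rw [Finset.mem_filter] at hp
      refine edge c0 hc0.1 p hp.1 (Or.inl fun x hx hx' => ?_) (by unfold Cross; omega)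
      have h1 := hmax' x hx
      have h2 := hmin' x hx
      have h3 : x ≠ a := fun h => haP (h ▸ hx)
      omega
    · have hall : ∀ x ∈ P, a < x := fun x hx => by
        by_contra hlt
        have h3 : x ≠ a := fun h => haP (h ▸ hx)
        exact hlow ⟨x, Finset.mem_filter.2 ⟨hx, by omega⟩⟩
      -- With no vertex of `P` below `a`, the edge over `a` is the one joining the least and the
      -- greatest vertex of `P`.
      obtain ⟨t, ht, hmax⟩ := P.exists_maximal ⟨c, hc⟩
      have hmax' : ∀ x ∈ P, x ≤ t := fun x hx => by
        by_contra hlt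
        exact hlt (hmax hx (by omega))
      have h1 := hall d hd
      have h2 := hmax' d hd
      refine edge c0 hc0.1 t ht (Or.inr fun x hx => ?_) (by unfold Cross; omega)
      have := hmin' x hx (hall x hx)
      have := hmax' x hx
      omega
  have hbP : b ∈ P := by
    by_contra hbP
    have hne : (P.filter (fun x => x < b)).Nonempty :=
      ⟨c, Finset.mem_filter.2 ⟨hc, by omega⟩⟩
    obtain ⟨c0, hc0, hmax⟩ := (P.filter (fun x => x < b)).exists_maximal hne
    have hmax' : ∀ x ∈ P, x < b → x ≤ c0 := fun x hx hax => by
      by_contra hlt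
      exact hlt (hmax (Finset.mem_filter.2 ⟨hx, hax⟩) (by omega))
    rw [Finset.mem_filter] at hc0
    have hcc := hmax' c hc (by omega)
    by_cases hhigh : (P.filter (fun x => b < x)).Nonempty
    · obtain ⟨p, hp, hmin⟩ := (P.filter (fun x => b < x)).exists_minimal hhigh
      have hmin' : ∀ x ∈ P, b < x → p ≤ x := fun x hx hax => by
        by_contra hlt
        exact hlt (hmin (Finset.mem_filter.2 ⟨hx, hax⟩) (by omega))
      rw [Finset.mem_filter] at hp
      refine edge c0 hc0.1 p hp.1 (Or.inl fun x hx hx' => ?_) (by unfold Cross; omega)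
      have h1 := hmax' x hx
      have h2 := hmin' x hx
      have h3 : x ≠ b := fun h => hbP (h ▸ hx)
      omega
    · have hall : ∀ x ∈ P, x < b := fun x hx => by
        by_contra hlt
        have h3 : x ≠ b := fun h => hbP (h ▸ hx)
        exact hhigh ⟨x, Finset.mem_filter.2 ⟨hx, by omega⟩⟩
      obtain ⟨t, ht, hmin⟩ := P.exists_minimal ⟨c, hc⟩
      have hmin' : ∀ x ∈ P, t ≤ x := fun x hx => by
        by_contra hlt
        exact hlt (hmin hx (by omega))
      have h1 := hall d hd
      have h2 := hmin' d hd
      refine edge c0 hc0.1 t ht (Or.inr fun x hx => ?_) (by unfold Cross; omega)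
      have := hmax' x hx (hall x hx)
      have := hmin' x hx
      omega
  -- Now `ab` is an edge between two vertices of the face, so they are neighbours in `P`, although
  -- `c` and `d` lie on different sides.
  exact consecutive_iff.1 ((hPE a haP b hbP hab.ne).1 hE) c hc d hd (by unfold Cross; omega)

/-! ### Cutting a planar drawing along a chord -/

/-- The edges in `E` draw the polygon with vertex set `V` and do not cross inside it. -/
structure IsPlanar (E : ℕ → ℕ → Prop) (V : Finset ℕ) : Prop where
  symm : ∀ a b, E a b → E b a
  noncrossing : ∀ a ∈ V, ∀ b ∈ V, ∀ c ∈ V, ∀ d ∈ V, E a b → E c d → ¬ Cross a b c d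
  side : ∀ a ∈ V, ∀ b ∈ V, a < b → Consecutive V a b → E a b

/-- The chord `ab` cuts the polygon `V` into the polygons `V₁` and `V₂`. -/
structure IsCut (V V₁ V₂ : Finset ℕ) (a b : ℕ) : Prop where
  lt : a < b
  left_mem : a ∈ V
  right_mem : b ∈ V
  mem_inner : ∀ x, x ∈ V₁ ↔ x ∈ V ∧ a ≤ x ∧ x ≤ b
  mem_outer : ∀ x, x ∈ V₂ ↔ x ∈ V ∧ (x ≤ a ∨ b ≤ x)

section Cut

variable {E : ℕ → ℕ → Prop} {V V₁ V₂ : Finset ℕ} {a b : ℕ}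

/-- A side of the piece is either a side of `V` or the cutting chord, which is drawn. -/
theorem IsPlanar.inner (hV : IsPlanar E V) (hc : IsCut V V₁ V₂ a b) (hE : E a b) :
    IsPlanar E V₁ where
  symm := hV.symm
  noncrossing x hx y hy z hz w hw := hV.noncrossing x ((hc.mem_inner x).1 hx).1
    y ((hc.mem_inner y).1 hy).1 z ((hc.mem_inner z).1 hz).1 w ((hc.mem_inner w).1 hw).1
  side x hx y hy hxy h := by
    rw [hc.mem_inner] at hx hy
    rcases h with h | h
    · refine hV.side x hx.1 y hy.1 hxy (Or.inl fun c hcV hlt => ?_)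
      exact h c ((hc.mem_inner c).2 ⟨hcV, by omega⟩) hlt
    · have h1 := h a ((hc.mem_inner a).2 ⟨hc.left_mem, le_rfl, hc.lt.le⟩)
      have h2 := h b ((hc.mem_inner b).2 ⟨hc.right_mem, hc.lt.le, le_rfl⟩)
      obtain rfl : x = a := by omega
      obtain rfl : y = b := by omega
      exact hE

theorem IsPlanar.outer (hV : IsPlanar E V) (hc : IsCut V V₁ V₂ a b) (hE : E a b) :
    IsPlanar E V₂ where
  symm := hV.symm
  noncrossing x hx y hy z hz w hw := hV.noncrossing x ((hc.mem_outer x).1 hx).1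
    y ((hc.mem_outer y).1 hy).1 z ((hc.mem_outer z).1 hz).1 w ((hc.mem_outer w).1 hw).1
  side x hx y hy hxy h := by
    rw [hc.mem_outer] at hx hy
    have ha := (hc.mem_outer a).2 ⟨hc.left_mem, Or.inl le_rfl⟩
    have hb := (hc.mem_outer b).2 ⟨hc.right_mem, Or.inr le_rfl⟩
    have hlt := hc.lt
    rcases h with h | h
    · by_cases hab : x = a ∧ y = b
      · rw [hab.1, hab.2]
        exact hE
      · have h1 := h a ha
        have h2 := h b hb
        refine hV.side x hx.1 y hy.1 hxy (Or.inl fun c hcV hlt => ?_)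
        exact h c ((hc.mem_outer c).2 ⟨hcV, by omega⟩) hlt
    · have h1 := h a ha
      have h2 := h b hb
      refine hV.side x hx.1 y hy.1 hxy (Or.inr fun c hcV => ?_)
      by_cases hco : c ≤ a ∨ b ≤ c
      · exact h c ((hc.mem_outer c).2 ⟨hcV, hco⟩)
      · omega

/-- No drawn edge crosses the chord `ab`, so by `IsFace.subset_side` no face has vertices strictly
on both sides of it. -/
theorem IsCut.faces_eq (hc : IsCut V V₁ V₂ a b) (hV : IsPlanar E V) (hE : E a b) :
    faces E V = faces E V₁ ∪ faces E V₂ := by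
  ext P
  simp only [Finset.mem_union, mem_faces, ← or_and_right, and_congr_left_iff]
  intro hP
  constructor
  · intro hPV
    refine (hP.subset_side hc.lt hE fun c hcP d hdP => hV.noncrossing a hc.left_mem b hc.right_mem
      c (hPV hcP) d (hPV hdP) hE).imp (fun h x hx => ?_) (fun h x hx => ?_)
    · exact (hc.mem_inner x).2 ⟨hPV hx, h x hx⟩
    · exact (hc.mem_outer x).2 ⟨hPV hx, h x hx⟩
  · rintro (h | h) x hx
    · exact ((hc.mem_inner x).1 (h hx)).1
    · exact ((hc.mem_outer x).1 (h hx)).1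

theorem IsCut.disjoint_faces (hc : IsCut V V₁ V₂ a b) : Disjoint (faces E V₁) (faces E V₂) := by
  rw [Finset.disjoint_left]
  intro P h1 h2
  rw [mem_faces] at h1 h2
  have hsub : P ⊆ {a, b} := by
    intro x hx
    have := (hc.mem_inner x).1 (h1.1 hx)
    have := (hc.mem_outer x).1 (h2.1 hx)
    simp only [Finset.mem_insert, Finset.mem_singleton]
    omega
  have := Finset.card_le_card hsub
  have := Finset.card_le_two (a := a) (b := b)
  have := h1.2.1
  omega

theorem IsCut.vertexDegree_eq (hc : IsCut V V₁ V₂ a b) (hV : IsPlanar E V) (hE : E a b) (i : ℕ) :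
    vertexDegree E V i = vertexDegree E V₁ i + vertexDegree E V₂ i := by
  rw [vertexDegree, hc.faces_eq hV hE, Finset.filter_union, Finset.card_union_of_disjoint]
  · rfl
  · exact Finset.disjoint_filter_filter hc.disjoint_faces

theorem IsCut.evenFaces_eq (hc : IsCut V V₁ V₂ a b) (hV : IsPlanar E V) (hE : E a b) :
    evenFaces E V = evenFaces E V₁ + evenFaces E V₂ := by
  rw [evenFaces, hc.faces_eq hV hE, Finset.filter_union, Finset.card_union_of_disjoint]
  · rfl
  · exact Finset.disjoint_filter_filter hc.disjoint_faces

end Cut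

/-- A drawing of a polygon that is not a single face has a chord with vertices on both sides. -/
theorem IsPlanar.exists_chord {E : ℕ → ℕ → Prop} {V : Finset ℕ} (hV : IsPlanar E V)
    (h3 : 3 ≤ V.card) (hn : ¬ IsFace E V) :
    ∃ a ∈ V, ∃ b ∈ V, a < b ∧ E a b ∧ ∃ c ∈ V, ∃ d ∈ V, Cross a b c d := by
  have key : ∃ a ∈ V, ∃ b ∈ V, a < b ∧ ¬ (E a b ↔ Consecutive V a b) := by
    by_contra hcon
    push Not at hcon
    refine hn ⟨h3, fun a ha b hb hab => ?_⟩
    rcases lt_or_gt_of_ne hab with h | h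
    · exact hcon a ha b hb h
    · rw [consecutive_comm, ← hcon b hb a ha h]
      exact ⟨hV.symm _ _, hV.symm _ _⟩
  obtain ⟨a, ha, b, hb, hab, h⟩ := key
  have hs := hV.side a ha b hb hab
  -- The sides of `V` are always drawn, so the equivalence can fail only by an edge between vertices
  -- that are not neighbours.
  have hE : E a b := by tauto
  have hnc : ¬ Consecutive V a b := by tauto
  rw [consecutive_iff] at hnc
  push Not at hnc
  exact ⟨a, ha, b, hb, hab, hE, hnc⟩

/-- A face contains no smaller face. -/
theorem IsFace.faces_eq_singleton {E : ℕ → ℕ → Prop} {V : Finset ℕ} (hF : IsFace E V)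
    : faces E V = {V} := by
  ext P
  rw [mem_faces, Finset.mem_singleton]
  constructor
  · rintro ⟨hPV, hP⟩
    refine hPV.antisymm fun x hx => ?_
    by_contra hxP
    -- Sides of `P` are edges, hence sides of the face `V`. The missing vertex `x` lies beyond some
    -- side of `P`, and a third vertex of `P` lies on the other side of it: a contradiction.
    have edge : ∀ c ∈ P, ∀ d ∈ P, c ≠ d → Consecutive P c d → Consecutive V c d :=
      fun c hc d hd hne h => (hF.2 c (hPV hc) d (hPV hd) hne).1 ((hP.2 c hc d hd hne).2 h)
    have third : ∀ c d, ∃ y ∈ P, y ≠ c ∧ y ≠ d := by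
      intro c d
      by_contra hcon
      push Not at hcon
      have hsub : P ⊆ {c, d} := fun y hy => by
        have := hcon y hy
        simp only [Finset.mem_insert, Finset.mem_singleton]
        tauto
      have := Finset.card_le_card hsub
      have := Finset.card_le_two (a := c) (b := d)
      have := hP.1
      omega
    have hPne : P.Nonempty := Finset.card_pos.1 (by have := hP.1; omega)
    obtain ⟨p, hp, hpmin⟩ := P.exists_minimal hPne
    obtain ⟨t, ht, htmax⟩ := P.exists_maximal hPne
    have hpmin' : ∀ y ∈ P, p ≤ y := fun y hy => by
      by_contra hlt
      exact hlt (hpmin hy (by omega))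
    have htmax' : ∀ y ∈ P, y ≤ t := fun y hy => by
      by_contra hlt
      exact hlt (htmax hy (by omega))
    by_cases hin : p < x ∧ x < t
    · obtain ⟨c, hc, hcmax⟩ := (P.filter (fun y => y < x)).exists_maximal
        ⟨p, Finset.mem_filter.2 ⟨hp, hin.1⟩⟩
      obtain ⟨d, hd, hdmin⟩ := (P.filter (fun y => x < y)).exists_minimal
        ⟨t, Finset.mem_filter.2 ⟨ht, hin.2⟩⟩
      have hc' : ∀ y ∈ P, y < x → y ≤ c := fun y hy hyx => by
        by_contra hlt
        exact hlt (hcmax (Finset.mem_filter.2 ⟨hy, hyx⟩) (by omega))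
      have hd' : ∀ y ∈ P, x < y → d ≤ y := fun y hy hyx => by
        by_contra hlt
        exact hlt (hdmin (Finset.mem_filter.2 ⟨hy, hyx⟩) (by omega))
      rw [Finset.mem_filter] at hc hd
      have hcons := edge c hc.1 d hd.1 (by omega) (Or.inl fun y hy hlt => by
        have h1 := hc' y hy
        have h2 := hd' y hy
        have h3 : y ≠ x := fun h => hxP (h ▸ hy)
        omega)
      obtain ⟨y, hy, hyc, hyd⟩ := third c d
      refine consecutive_iff.1 hcons x hx y (hPV hy) ?_
      have h1 := hc' y hy
      have h2 := hd' y hy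
      have h3 : y ≠ x := fun h => hxP (h ▸ hy)
      unfold Cross
      omega
    -- Here `x` is below or above all of `P`, so the side in question joins the least and the
    -- greatest vertex.
    · obtain ⟨y, hy, hyp, hyt⟩ := third p t
      have h1 := hpmin' y hy
      have h2 := htmax' y hy
      have hcons := edge p hp t ht (by omega) (Or.inr fun z hz => by
        have h1 := hpmin' z hz
        have h2 := htmax' z hz
        omega)
      refine consecutive_iff.1 hcons y (hPV hy) x hx ?_
      have h3 : p ≠ x := fun h => hxP (h ▸ hp)
      have h4 : t ≠ x := fun h => hxP (h ▸ ht)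
      unfold Cross
      omega
  · rintro rfl
    exact ⟨subset_rfl, hF⟩

theorem IsCut.filter {V : Finset ℕ} {a b : ℕ} (hab : a < b) (ha : a ∈ V) (hb : b ∈ V) :
    IsCut V (V.filter fun x => a ≤ x ∧ x ≤ b) (V.filter fun x => x ≤ a ∨ b ≤ x) a b :=
  ⟨hab, ha, hb, fun _ => Finset.mem_filter, fun _ => Finset.mem_filter⟩

/-- Cutting along chords ends in single faces, and each vertex survives in at least one piece of
every cut. -/
theorem IsPlanar.vertexDegree_pos {E : ℕ → ℕ → Prop} {V : Finset ℕ} (hV : IsPlanar E V)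
    (h3 : 3 ≤ V.card) {i : ℕ} (hi : i ∈ V) : 0 < vertexDegree E V i := by
  induction hN : V.card using Nat.strong_induction_on generalizing V with
  | _ N ih =>
  subst hN
  by_cases hF : IsFace E V
  · exact Finset.card_pos.2 ⟨V, Finset.mem_filter.2 ⟨mem_faces.2 ⟨subset_rfl, hF⟩, hi⟩⟩
  · obtain ⟨a, ha, b, hb, hab, hE, c, hc, d, hd, hx⟩ := hV.exists_chord h3 hF
    have hcut := IsCut.filter hab ha hb
    have hlt1 : (V.filter fun x => a ≤ x ∧ x ≤ b).card < V.card :=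
      Finset.card_lt_card (Finset.filter_ssubset.2 ⟨d, hd, by unfold Cross at hx; omega⟩)
    have hlt2 : (V.filter fun x => x ≤ a ∨ b ≤ x).card < V.card :=
      Finset.card_lt_card (Finset.filter_ssubset.2 ⟨c, hc, by unfold Cross at hx; omega⟩)
    have three : ∀ (y : ℕ) (U : Finset ℕ), y ≠ a → y ≠ b → y ∈ U → a ∈ U → b ∈ U → 3 ≤ U.card := by
      intro y U hya hyb hy ha hb
      rw [← Finset.card_eq_three.2 ⟨y, a, b, hya, hyb, hab.ne, rfl⟩]
      apply Finset.card_le_card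
      intro z hz
      simp only [Finset.mem_insert, Finset.mem_singleton] at hz
      rcases hz with rfl | rfl | rfl <;> assumption
    rw [hcut.vertexDegree_eq hV hE]
    unfold Cross at hx
    by_cases hin : a ≤ i ∧ i ≤ b
    · have := ih _ hlt1 (hV.inner hcut hE) (three c _ (by omega) (by omega)
        (Finset.mem_filter.2 ⟨hc, by omega⟩) (Finset.mem_filter.2 ⟨ha, by omega⟩)
        (Finset.mem_filter.2 ⟨hb, by omega⟩)) (Finset.mem_filter.2 ⟨hi, hin⟩) rfl
      omega
    · have := ih _ hlt2 (hV.outer hcut hE) (three d _ (by omega) (by omega)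
        (Finset.mem_filter.2 ⟨hd, by omega⟩) (Finset.mem_filter.2 ⟨ha, by omega⟩)
        (Finset.mem_filter.2 ⟨hb, by omega⟩)) (Finset.mem_filter.2 ⟨hi, by omega⟩) rfl
      omega

/-! ### The matrix product of a quiddity sequence -/

theorem M_append (x y : List ℤ) : M (x ++ y) = M y * M x := by
  simp [M]

theorem M_cons (x : ℤ) (y : List ℤ) : M (x :: y) = M y * !![x, -1; 1, 0] := by
  simp [M]

/-- Splits the degree at an end of a diagonal into the contributions of the two pieces. -/
theorem step_add (x y : ℤ) : (!![x + y, -1; 1, 0] : Matrix (Fin 2) (Fin 2) ℤ) =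
    -(!![x, -1; 1, 0] * !![0, -1; 1, 0] * !![y, -1; 1, 0]) := by
  ext i j
  fin_cases i <;> fin_cases j <;> simp

theorem M_replicate_one (j : ℕ) : M (List.replicate (3 * j) 1) = (-1) ^ j := by
  have h : (!![1, -1; 1, 0] : Matrix (Fin 2) (Fin 2) ℤ) ^ 3 = -1 := by
    rw [pow_succ, pow_two]
    ext i j
    fin_cases i <;> fin_cases j <;> simp [Matrix.mul_apply, Fin.sum_univ_two]
  rw [M, List.reverse_replicate, List.map_replicate, List.prod_replicate, pow_mul, h]

/-- Gluing two cyclic words along an edge. -/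
theorem M_glue (L W R : List ℤ) (a₁ a₂ b₁ b₂ : ℤ) {e₁ e₂ : ℕ}
    (h₁ : M (a₁ :: W ++ [b₁]) = (-1) ^ e₁) (h₂ : M (L ++ a₂ :: b₂ :: R) = (-1) ^ e₂) :
    M (L ++ (a₁ + a₂) :: W ++ (b₁ + b₂) :: R) = (-1) ^ (e₁ + e₂ + 1) := by
  have h0 : (!![0, -1; 1, 0] : Matrix (Fin 2) (Fin 2) ℤ) * !![0, -1; 1, 0] = -1 := by
    ext i j
    fin_cases i <;> fin_cases j <;> simp [Matrix.mul_apply, Fin.sum_univ_two]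
  simp only [M_append, M_cons, List.append_assoc, List.cons_append] at h₁ h₂ ⊢
  -- The order of the summands matters: after splitting, `b₁` and `a₁` must both stand next to `W`,
  -- so that the inner word can be collapsed to a sign. The minus signs of the two splittings
  -- cancel, and the remaining M(0)² = -1 is the extra sign.
  rw [show b₁ + b₂ = b₂ + b₁ by ring, step_add, step_add]
  have hM : M [] = 1 := by simp [M]
  rw [hM, one_mul] at h₁
  set A₁ := (!![a₁, -1; 1, 0] : Matrix (Fin 2) (Fin 2) ℤ)
  set A₂ := (!![a₂, -1; 1, 0] : Matrix (Fin 2) (Fin 2) ℤ)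
  set B₁ := (!![b₁, -1; 1, 0] : Matrix (Fin 2) (Fin 2) ℤ)
  set B₂ := (!![b₂, -1; 1, 0] : Matrix (Fin 2) (Fin 2) ℤ)
  set Z := (!![0, -1; 1, 0] : Matrix (Fin 2) (Fin 2) ℤ)
  have hcomm : ∀ X : Matrix (Fin 2) (Fin 2) ℤ, X * (-1) ^ e₁ = (-1) ^ e₁ * X :=
    fun X => (((Commute.one_right X).neg_right).pow_right e₁).eq
  calc _ = M R * B₂ * (Z * (B₁ * M W * A₁) * Z) * A₂ * M L := by noncomm_ring
    _ = M R * B₂ * ((-1) ^ e₁ * -1) * A₂ * M L := by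
        rw [show B₁ * M W * A₁ = (-1) ^ e₁ by rw [← h₁], hcomm, mul_assoc _ Z Z, h0]
    _ = (-1) ^ e₁ * (M R * B₂ * A₂ * M L) * -1 := by
        rw [← mul_assoc (M R * B₂), hcomm]; noncomm_ring
    _ = _ := by rw [h₂, pow_succ, pow_add]

/-- Induction on the number of vertices: a single face gives a word of ones, and otherwise
`IsPlanar.exists_chord` provides a cut to which `M_glue` applies. The increasing list `l` serves to
read the vertices in cyclic order for an arbitrary vertex set. -/
theorem M_vertexDegree {E : ℕ → ℕ → Prop} (l : List ℕ) (hl : l.Pairwise (· < ·))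
    (h2 : 2 ≤ l.length) (hV : IsPlanar E l.toFinset)
    (h3 : ∀ P ∈ faces E l.toFinset, 3 ∣ P.card) :
    M (l.map fun i => (vertexDegree E l.toFinset i : ℤ)) =
      (-1) ^ (evenFaces E l.toFinset + 1) := by
  induction hN : l.length using Nat.strong_induction_on generalizing l with
  | _ N ih =>
  subst hN
  have hnodup : l.Nodup := hl.imp ne_of_lt
  have hcard : l.toFinset.card = l.length := List.toFinset_card_of_nodup hnodup
  by_cases hlen : l.length = 2
  · have hempty : faces E l.toFinset = ∅ := by
      rw [Finset.eq_empty_iff_forall_notMem]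
      intro P hP
      rw [mem_faces] at hP
      have := Finset.card_le_card hP.1
      have := hP.2.1
      omega
    obtain ⟨a, b, rfl⟩ := List.length_eq_two.1 hlen
    simp only [vertexDegree, evenFaces, hempty, Finset.filter_empty, Finset.card_empty,
      List.map_cons, List.map_nil, M]
    ext i j
    fin_cases i <;> fin_cases j <;> simp
  by_cases hF : IsFace E l.toFinset
  · have hfaces := hF.faces_eq_singleton
    obtain ⟨j, hj⟩ := h3 l.toFinset (by rw [hfaces]; exact Finset.mem_singleton_self _)
    have hone : (l.map fun i => (vertexDegree E l.toFinset i : ℤ)) = List.replicate (3 * j) 1 := by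
      rw [← hj, hcard, List.eq_replicate_iff]
      refine ⟨List.length_map _, fun x hx => ?_⟩
      obtain ⟨i, hi, rfl⟩ := List.mem_map.1 hx
      rw [vertexDegree, hfaces, Finset.filter_singleton, if_pos (List.mem_toFinset.2 hi)]
      simp
    rw [hone, M_replicate_one, evenFaces, hfaces, Finset.filter_singleton, hj]
    -- `j` and `3 * j` have the same parity, so the sign (-1)^j records whether the face is even.
    rcases Nat.even_or_odd j with h | h
    · rw [if_pos (h.mul_left 3), h.neg_one_pow]
      simp
    · have hodd : Odd (3 * j) := (by decide : Odd 3).mul h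
      rw [if_neg (Nat.not_even_iff_odd.2 hodd), h.neg_one_pow]
      simp
  obtain ⟨a, ha, b, hb, hab, hE, c, hc, d, hd, hx⟩ := hV.exists_chord (by omega) hF
  rw [List.mem_toFinset] at ha hb hc hd
  obtain ⟨L, l', rfl⟩ := List.append_of_mem ha
  have hpw := hl
  simp only [List.pairwise_append, List.pairwise_cons, List.mem_cons] at hpw
  have hb' : b ∈ l' := by
    simp only [List.mem_append, List.mem_cons] at hb
    rcases hb with h | h | h
    · have := hpw.2.2 b h a (Or.inl rfl)
      omega
    · omega
    · exact h
  -- The list is now `L, a, W, b, R`; the chord cuts it into `a, W, b` and `L, a, b, R`.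
  obtain ⟨W, R, rfl⟩ := List.append_of_mem hb'
  simp only [List.pairwise_append, List.pairwise_cons, List.mem_append, List.mem_cons] at hpw
  obtain ⟨hL, ⟨haWR, hW, ⟨hbR, hR⟩, hWbR⟩, hLa⟩ := hpw
  set V₁ := (a :: W ++ [b]).toFinset with hV₁
  set V₂ := (L ++ a :: b :: R).toFinset with hV₂
  have hLlt : ∀ x ∈ L, x < a := fun x hx => hLa x hx a (Or.inl rfl)
  have hcut : IsCut (L ++ a :: (W ++ b :: R)).toFinset V₁ V₂ a b := by
    refine ⟨hab, by simp, by simp, fun x => ?_, fun x => ?_⟩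
    · simp only [hV₁, List.mem_toFinset, List.mem_append, List.mem_cons, List.not_mem_nil,
        or_false]
      constructor
      · rintro ((rfl | h) | rfl)
        · exact ⟨by simp, by omega⟩
        · exact ⟨by simp [h], (haWR x (Or.inl h)).le, (hWbR x h b (Or.inl rfl)).le⟩
        · exact ⟨by simp, by omega⟩
      · rintro ⟨h | h | h | h | h, h1, h2⟩
        · have := hLlt x h
          omega
        · exact Or.inl (Or.inl h)
        · exact Or.inl (Or.inr h)
        · exact Or.inr h
        · have := hbR x h
          omega
    · simp only [hV₂, List.mem_toFinset, List.mem_append, List.mem_cons]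
      constructor
      · rintro (h | rfl | rfl | h)
        · exact ⟨by simp [h], Or.inl (hLlt x h).le⟩
        · exact ⟨by simp, by omega⟩
        · exact ⟨by simp, by omega⟩
        · exact ⟨by simp [h], Or.inr (hbR x h).le⟩
      · rintro ⟨h | h | h | h | h, h1⟩
        · exact Or.inl h
        · exact Or.inr (Or.inl h)
        · have := haWR x (Or.inl h)
          have := hWbR x h b (Or.inl rfl)
          omega
        · exact Or.inr (Or.inr (Or.inl h))
        · exact Or.inr (Or.inr (Or.inr h))
  have hcW : c ∈ W := by
    simp only [List.mem_append, List.mem_cons] at hc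
    unfold Cross at hx
    rcases hc with h | h | h | h | h
    · have := hLlt c h
      omega
    · omega
    · exact h
    · omega
    · have := hbR c h
      omega
  have hdLR : d ∈ L ∨ d ∈ R := by
    simp only [List.mem_append, List.mem_cons] at hd
    unfold Cross at hx
    rcases hd with h | h | h | h | h
    · exact Or.inl h
    · omega
    · have := haWR d (Or.inl h)
      have := hWbR d h b (Or.inl rfl)
      omega
    · omega
    · exact Or.inr h
  have hWlen := List.length_pos_of_mem hcW
  have hLRlen : 0 < L.length + R.length := by
    rcases hdLR with h | h
    · have := List.length_pos_of_mem h
      omega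
    · have := List.length_pos_of_mem h
      omega
  have hfaces := hcut.faces_eq hV hE
  have ih₁ := ih _ (by simp; omega) (a :: W ++ [b])
    (hl.sublist (by
      refine List.Sublist.trans ?_ (List.sublist_append_right L _)
      simp)) (by simp) (hV.inner hcut hE)
    (fun P hP => h3 P (by rw [hfaces]; exact Finset.mem_union_left _ hP)) rfl
  have ih₂ := ih _ (by simp; omega) (L ++ a :: b :: R)
    (hl.sublist (by simp)) (by simp; omega) (hV.outer hcut hE)
    (fun P hP => h3 P (by rw [hfaces]; exact Finset.mem_union_right _ hP)) rfl
  rw [← hV₁] at ih₁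
  rw [← hV₂] at ih₂
  have notIn : ∀ x ∈ W, vertexDegree E V₂ x = 0 := fun x hx => vertexDegree_eq_zero fun h => by
    have := ((hcut.mem_outer x).1 h).2
    have := haWR x (Or.inl hx)
    have := hWbR x hx b (Or.inl rfl)
    omega
  have notInL : ∀ x ∈ L, vertexDegree E V₁ x = 0 := fun x hx => vertexDegree_eq_zero fun h => by
    have := ((hcut.mem_inner x).1 h).2
    have := hLlt x hx
    omega
  have notInR : ∀ x ∈ R, vertexDegree E V₁ x = 0 := fun x hx => vertexDegree_eq_zero fun h => by
    have := ((hcut.mem_inner x).1 h).2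
    have := hbR x hx
    omega
  have hdeg := hcut.vertexDegree_eq hV hE
  have key := M_glue (L.map fun i => (vertexDegree E V₂ i : ℤ))
    (W.map fun i => (vertexDegree E V₁ i : ℤ)) (R.map fun i => (vertexDegree E V₂ i : ℤ))
    (vertexDegree E V₁ a) (vertexDegree E V₂ a) (vertexDegree E V₁ b) (vertexDegree E V₂ b)
    (by simpa using ih₁) (by simpa using ih₂)
  rw [hcut.evenFaces_eq hV hE]
  have hlist : ((L ++ a :: (W ++ b :: R)).map fun i =>
      (vertexDegree E (L ++ a :: (W ++ b :: R)).toFinset i : ℤ)) =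
      (L.map fun i => (vertexDegree E V₂ i : ℤ)) ++
        ((vertexDegree E V₁ a : ℤ) + vertexDegree E V₂ a) ::
          (W.map fun i => (vertexDegree E V₁ i : ℤ)) ++
        ((vertexDegree E V₁ b : ℤ) + vertexDegree E V₂ b) ::
          (R.map fun i => (vertexDegree E V₂ i : ℤ)) := by
    simp only [hdeg, List.map_append, List.map_cons, Nat.cast_add, List.append_assoc,
      List.cons_append]
    rw [List.map_congr_left (l := L) (g := fun i => (vertexDegree E V₂ i : ℤ)) (by
        intro x hx; simp [notInL x hx]),
      List.map_congr_left (l := R) (g := fun i => (vertexDegree E V₂ i : ℤ)) (by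
        intro x hx; simp [notInR x hx]),
      List.map_congr_left (l := W) (g := fun i => (vertexDegree E V₁ i : ℤ)) (by
        intro x hx; simp [notIn x hx])]
  rw [hlist, key]
  rw [show evenFaces E V₁ + 1 + (evenFaces E V₂ + 1) + 1 =
    evenFaces E V₁ + evenFaces E V₂ + 1 + 2 by ring, pow_add _ _ 2]
  simp

/-! ### Dissections as planar drawings -/

/-- `a` and `b` are joined by a side of the `n`-gon or a diagonal in `D`. -/
def Edge (n : ℕ) (D : Finset (Sym2 ℕ)) (a b : ℕ) : Prop := IsSide n a b ∨ s(a, b) ∈ D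

theorem subPolygons_eq_faces (n : ℕ) (D : Finset (Sym2 ℕ)) :
    subPolygons n D = faces (Edge n D) (Finset.Icc 1 n) := by
  ext P
  rw [mem_faces, subPolygons, Finset.mem_filter, Finset.mem_powerset]
  rfl

theorem isSide_of_consecutive {n a b : ℕ} (ha : a ∈ Finset.Icc 1 n) (hb : b ∈ Finset.Icc 1 n)
    (hab : a < b) (h : Consecutive (Finset.Icc 1 n) a b) : IsSide n a b := by
  rw [Finset.mem_Icc] at ha hb
  unfold IsSide next
  rcases h with h | h
  · have := h (a + 1) (Finset.mem_Icc.2 (by omega))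
    split_ifs <;> omega
  · have := h 1 (Finset.mem_Icc.2 (by omega))
    have := h n (Finset.mem_Icc.2 (by omega))
    split_ifs <;> omega

theorem IsSide.not_cross {n a b c d : ℕ} (h : IsSide n a b) (ha : a ∈ Finset.Icc 1 n)
    (hb : b ∈ Finset.Icc 1 n) (hc : c ∈ Finset.Icc 1 n) (hd : d ∈ Finset.Icc 1 n) :
    ¬ Cross a b c d := by
  rw [Finset.mem_Icc] at ha hb hc hd
  unfold IsSide next at h
  unfold Cross
  split_ifs at h <;> omega

theorem Cross.symm_or {a b c d : ℕ} (h : Cross a b c d) : Cross c d a b ∨ Cross c d b a := by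
  unfold Cross at *
  omega

theorem Cross.ne {a b c d : ℕ} (h : Cross a b c d) :
    a ≠ b ∧ c ≠ d ∧ c ≠ a ∧ c ≠ b ∧ d ≠ a ∧ d ≠ b := by
  unfold Cross at h
  omega

theorem IsDissection.not_cross {n : ℕ} {D : Finset (Sym2 ℕ)} (hD : IsDissection n D)
    {a b c d : ℕ} (hab : s(a, b) ∈ D) (hcd : s(c, d) ∈ D) : ¬ Cross a b c d := by
  intro h
  have hba : s(b, a) ∈ D := by rwa [Sym2.eq_swap]
  have hdc : s(d, c) ∈ D := by rwa [Sym2.eq_swap]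
  unfold Cross at h
  rcases le_total a b with hle | hle
  · rw [min_eq_left hle, max_eq_right hle] at h
    rcases h.2 with h' | h'
    · exact hD.noncrossing d a c b h' h.1.1 h.1.2 ⟨hdc, hab⟩
    · exact hD.noncrossing a c b d h.1.1 h.1.2 h' ⟨hab, hcd⟩
  · rw [min_eq_right hle, max_eq_left hle] at h
    rcases h.2 with h' | h'
    · exact hD.noncrossing d b c a h' h.1.1 h.1.2 ⟨hdc, hba⟩
    · exact hD.noncrossing b c a d h.1.1 h.1.2 h' ⟨hba, hcd⟩

theorem IsDissection.isPlanar {n : ℕ} {D : Finset (Sym2 ℕ)} (hD : IsDissection n D) :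
    IsPlanar (Edge n D) (Finset.Icc 1 n) where
  symm a b h := by
    rcases h with h | h
    · exact Or.inl h.symm
    · exact Or.inr (by rwa [Sym2.eq_swap])
  noncrossing a ha b hb c hc d hd hab hcd h := by
    rcases hab with hab | hab
    · exact hab.not_cross ha hb hc hd h
    rcases hcd with hcd | hcd
    · rcases h.symm_or with h | h
      · exact hcd.not_cross hc hd ha hb h
      · exact hcd.not_cross hc hd hb ha h
    · exact hD.not_cross hab hcd h
  side a ha b hb hab h := Or.inl (isSide_of_consecutive ha hb hab h)

theorem quiddity_eq (n : ℕ) (D : Finset (Sym2 ℕ)) :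
    quiddity n D = (List.range' 1 n).map (vertexDegree (Edge n D) (Finset.Icc 1 n)) := by
  simp only [quiddity, subPolygons_eq_faces]
  rfl

theorem index_eq (n : ℕ) (D : Finset (Sym2 ℕ)) :
    index n D = evenFaces (Edge n D) (Finset.Icc 1 n) := by
  simp only [index, subPolygons_eq_faces]
  rfl

theorem isPositiveSolution_quiddity {n : ℕ} {D : Finset (Sym2 ℕ)} (hD : IsEven3d n D) :
    IsPositiveSolution n (quiddity n D) := by
  obtain ⟨⟨hD, h3⟩, heven⟩ := hD
  have hn := hD.three_le
  have hset : (List.range' 1 n).toFinset = Finset.Icc 1 n := by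
    ext x
    simp only [List.mem_toFinset, List.mem_range'_1, Finset.mem_Icc]
    omega
  refine ⟨by simp [quiddity], fun x hx => ?_, ?_⟩
  · rw [quiddity_eq] at hx
    obtain ⟨i, hi, rfl⟩ := List.mem_map.1 hx
    refine hD.isPlanar.vertexDegree_pos (by simpa using hn) ?_
    rwa [← hset, List.mem_toFinset]
  · have := M_vertexDegree (E := Edge n D) (List.range' 1 n) (List.pairwise_lt_range' ..)
      (by simp; omega) (by rw [hset]; exact hD.isPlanar)
      (by rw [hset, ← subPolygons_eq_faces]; exact h3)
    rw [hset, ← index_eq, pow_succ, heven.neg_one_pow, one_mul] at this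
    rw [quiddity_eq, ← this]
    simp [List.flatMap_map, ← List.map_eq_flatMap, Function.comp_def]

/-! ### Relabelling by cyclic embeddings -/

/-- The chords `ab` and `cd` cross. -/
def Crosses (a b c d : ℕ) : Prop := Cross a b c d ∨ Cross a b d c

theorem consecutive_iff_crosses {P : Finset ℕ} {a b : ℕ} :
    Consecutive P a b ↔ ∀ c ∈ P, ∀ d ∈ P, ¬ Crosses a b c d := by
  rw [consecutive_iff]
  constructor
  · rintro h c hc d hd (h' | h')
    · exact h c hc d hd h'
    · exact h d hd c hc h'
  · exact fun h c hc d hd h' => h c hc d hd (Or.inl h')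

/-- `f` respects the cyclic order of the vertices in `V`. -/
structure IsCyclicEmbedding (f : ℕ → ℕ) (V : Finset ℕ) : Prop where
  injOn : ∀ a ∈ V, ∀ b ∈ V, f a = f b → a = b
  crosses : ∀ a ∈ V, ∀ b ∈ V, ∀ c ∈ V, ∀ d ∈ V,
    Crosses (f a) (f b) (f c) (f d) ↔ Crosses a b c d

section Embedding

variable {f : ℕ → ℕ} {V : Finset ℕ} {E E' : ℕ → ℕ → Prop}

theorem IsCyclicEmbedding.consecutive_image (hf : IsCyclicEmbedding f V) {P : Finset ℕ}
    (hP : P ⊆ V) {a b : ℕ} (ha : a ∈ V) (hb : b ∈ V) :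
    Consecutive (P.image f) (f a) (f b) ↔ Consecutive P a b := by
  simp only [consecutive_iff_crosses, Finset.forall_mem_image]
  exact forall₂_congr fun c hc => forall₂_congr fun d hd =>
    not_congr (hf.crosses a ha b hb c (hP hc) d (hP hd))

theorem IsCyclicEmbedding.card_image (hf : IsCyclicEmbedding f V) {P : Finset ℕ} (hP : P ⊆ V) :
    (P.image f).card = P.card :=
  Finset.card_image_of_injOn fun a ha b hb => hf.injOn a (hP ha) b (hP hb)

theorem IsCyclicEmbedding.isFace_image (hf : IsCyclicEmbedding f V)
    (hE : ∀ a ∈ V, ∀ b ∈ V, a ≠ b → (E (f a) (f b) ↔ E' a b)) {P : Finset ℕ} (hP : P ⊆ V) :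
    IsFace E (P.image f) ↔ IsFace E' P := by
  simp only [IsFace, hf.card_image hP, Finset.forall_mem_image]
  refine and_congr_right fun _ => forall₂_congr fun a ha => forall₂_congr fun b hb => ?_
  rw [hf.consecutive_image hP (hP ha) (hP hb)]
  constructor
  · intro h hab
    rw [← hE a (hP ha) b (hP hb) hab]
    exact h fun h' => hab (hf.injOn a (hP ha) b (hP hb) h')
  · intro h hab
    have hab' : a ≠ b := fun h' => hab (congrArg f h')
    rw [hE a (hP ha) b (hP hb) hab']
    exact h hab'

theorem IsCyclicEmbedding.faces_image (hf : IsCyclicEmbedding f V)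
    (hE : ∀ a ∈ V, ∀ b ∈ V, a ≠ b → (E (f a) (f b) ↔ E' a b)) :
    faces E (V.image f) = (faces E' V).image (Finset.image f) := by
  ext Q
  simp only [mem_faces, Finset.mem_image (b := Q)]
  constructor
  · rintro ⟨hQ, hF⟩
    obtain ⟨P, hP, rfl⟩ := Finset.subset_image_iff.1 hQ
    exact ⟨P, ⟨hP, (hf.isFace_image hE hP).1 hF⟩, rfl⟩
  · rintro ⟨P, ⟨hP, hF⟩, rfl⟩
    exact ⟨Finset.image_subset_image hP, (hf.isFace_image hE hP).2 hF⟩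

theorem IsCyclicEmbedding.mem_image (hf : IsCyclicEmbedding f V) {P : Finset ℕ} (hP : P ⊆ V)
    {i : ℕ} (hi : i ∈ V) : f i ∈ P.image f ↔ i ∈ P := by
  rw [Finset.mem_image]
  constructor
  · rintro ⟨a, ha, h⟩
    rwa [← hf.injOn a (hP ha) i hi h]
  · exact fun h => ⟨i, h, rfl⟩

/-- Common source of `IsCyclicEmbedding.vertexDegree_image` and `IsCyclicEmbedding.evenFaces_image`:
taking images is injective on vertex sets inside `V`. -/
theorem IsCyclicEmbedding.card_filter_faces_image (hf : IsCyclicEmbedding f V)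
    (hE : ∀ a ∈ V, ∀ b ∈ V, a ≠ b → (E (f a) (f b) ↔ E' a b))
    (p q : Finset ℕ → Prop) [DecidablePred p] [DecidablePred q]
    (hpq : ∀ P ⊆ V, (p (P.image f) ↔ q P)) :
    ((faces E (V.image f)).filter p).card = ((faces E' V).filter q).card := by
  rw [hf.faces_image hE, Finset.filter_image, Finset.card_image_of_injOn]
  · congr 1
    exact Finset.filter_congr fun P hP => hpq P (mem_faces.1 hP).1
  · intro P hP Q hQ h
    have hP' := (mem_faces.1 (Finset.mem_filter.1 hP).1).1
    have hQ' := (mem_faces.1 (Finset.mem_filter.1 hQ).1).1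
    ext x
    constructor
    · intro hx
      rw [← hf.mem_image hQ' (hP' hx), ← show P.image f = Q.image f from h]
      exact Finset.mem_image_of_mem f hx
    · intro hx
      rw [← hf.mem_image hP' (hQ' hx), show P.image f = Q.image f from h]
      exact Finset.mem_image_of_mem f hx

theorem IsCyclicEmbedding.vertexDegree_image (hf : IsCyclicEmbedding f V)
    (hE : ∀ a ∈ V, ∀ b ∈ V, a ≠ b → (E (f a) (f b) ↔ E' a b)) {i : ℕ} (hi : i ∈ V) :
    vertexDegree E (V.image f) (f i) = vertexDegree E' V i :=
  hf.card_filter_faces_image hE _ _ fun _ hP => hf.mem_image hP hi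

theorem IsCyclicEmbedding.evenFaces_image (hf : IsCyclicEmbedding f V)
    (hE : ∀ a ∈ V, ∀ b ∈ V, a ≠ b → (E (f a) (f b) ↔ E' a b)) :
    evenFaces E (V.image f) = evenFaces E' V :=
  hf.card_filter_faces_image hE _ _ fun _ hP => by rw [hf.card_image hP]

theorem IsCyclicEmbedding.of_strictMonoOn (hf : StrictMonoOn f V) : IsCyclicEmbedding f V where
  injOn a ha b hb h := hf.injOn ha hb h
  crosses a ha b hb c hc d hd := by
    simp only [Crosses, Cross, min_lt_iff, lt_max_iff, lt_min_iff, max_lt_iff,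
      hf.lt_iff_lt ha hc, hf.lt_iff_lt ha hd, hf.lt_iff_lt hb hc, hf.lt_iff_lt hb hd,
      hf.lt_iff_lt hc ha, hf.lt_iff_lt hd ha, hf.lt_iff_lt hc hb, hf.lt_iff_lt hd hb]

end Embedding

/-! ### The gluing construction and its edges -/

/-- The label in the glued polygon of vertex `i` of the second polygon: vertex `1` lies on
vertex `k` of the first polygon, the others follow vertex `j` of the first polygon. -/
def glueLabel (m j k i : ℕ) : ℕ := if i = 1 then shift m j k else j + i - 1

/-- The `m`-gon is glued into the `n`-gon between the vertices `j` and `next n j`: its vertex `1` is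
put on `k`, its vertex `r` is joined to `l`, and `{k, l} = {j, next n j}`. -/
structure IsGluing (n m j k l r : ℕ) : Prop where
  three_le_left : 3 ≤ n
  three_le_right : 3 ≤ m
  one_le : 1 ≤ j
  le : j ≤ n
  cases : k = j ∧ l = next n j ∧ r = m ∨ k = next n j ∧ l = j ∧ r = 2

/-- The dissection glued from `S` and `T`. -/
def glue (m j k l r : ℕ) (S T : Finset (Sym2 ℕ)) : Finset (Sym2 ℕ) :=
  S.image (Sym2.map (shift m j)) ∪ T.image (Sym2.map (glueLabel m j k)) ∪
    {s(shift m j k, shift m j l), s(glueLabel m j k 1, glueLabel m j k r)}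

theorem shift_strictMono (m j : ℕ) : StrictMono (shift m j) := by
  intro a b hab
  unfold shift
  split_ifs <;> omega

theorem isCyclicEmbedding_shift (m j : ℕ) (V : Finset ℕ) : IsCyclicEmbedding (shift m j) V :=
  .of_strictMonoOn ((shift_strictMono m j).strictMonoOn _)

/-- Moving vertex `1` behind all others does not change which chords cross. -/
theorem crosses_rotate {a b c d : ℕ} (ha : 1 ≤ a) (hb : 1 ≤ b) (hc : 1 ≤ c) (hd : 1 ≤ d) :
    (((a ≠ 1 ∧ (c = 1 ∨ a < c) ∨ b ≠ 1 ∧ (c = 1 ∨ b < c)) ∧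
        (c ≠ 1 ∧ (a = 1 ∨ c < a) ∨ c ≠ 1 ∧ (b = 1 ∨ c < b))) ∧
        ((d ≠ 1 ∧ (a = 1 ∨ d < a)) ∧ (d ≠ 1 ∧ (b = 1 ∨ d < b)) ∨
          (a ≠ 1 ∧ (d = 1 ∨ a < d)) ∧ (b ≠ 1 ∧ (d = 1 ∨ b < d))) ∨
      ((a ≠ 1 ∧ (d = 1 ∨ a < d) ∨ b ≠ 1 ∧ (d = 1 ∨ b < d)) ∧
        (d ≠ 1 ∧ (a = 1 ∨ d < a) ∨ d ≠ 1 ∧ (b = 1 ∨ d < b))) ∧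
        ((c ≠ 1 ∧ (a = 1 ∨ c < a)) ∧ (c ≠ 1 ∧ (b = 1 ∨ c < b)) ∨
          (a ≠ 1 ∧ (c = 1 ∨ a < c)) ∧ (b ≠ 1 ∧ (c = 1 ∨ b < c)))) ↔
    (((a < c ∨ b < c) ∧ (c < a ∨ c < b)) ∧ (d < a ∧ d < b ∨ a < d ∧ b < d) ∨
      ((a < d ∨ b < d) ∧ (d < a ∨ d < b)) ∧ (c < a ∧ c < b ∨ a < c ∧ b < c)) := by
  rcases eq_or_ne a 1 with rfl | ha' <;> rcases eq_or_ne b 1 with rfl | hb' <;>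
  rcases eq_or_ne c 1 with rfl | hc' <;> rcases eq_or_ne d 1 with rfl | hd' <;>
  simp only [*, ne_eq, not_true_eq_false, false_and, and_false, true_and, and_true,
    or_false, false_or, true_or, or_true, not_false_eq_true, lt_irrefl, or_self, and_self] <;>
  constructor <;> intro h <;> first | exact h.elim | omega

theorem IsGluing.isCyclicEmbedding_glueLabel {n m j k l r : ℕ} (h : IsGluing n m j k l r) :
    IsCyclicEmbedding (glueLabel m j k) (Finset.Icc 1 m) := by
  obtain ⟨h1, h2, h3, h4, h5⟩ := h
  by_cases hk : shift m j k ≤ j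
  -- Vertex `1` goes to `j`, or to `1` if `j = n` and `k = 1`; in both cases it stays below the
  -- labels `j + 1, …, j + m - 1`.
  · refine .of_strictMonoOn fun a ha b hb hab => ?_
    simp only [Finset.coe_Icc, Set.mem_Icc] at ha hb
    unfold glueLabel
    split_ifs <;> omega
  -- Here `k = j + 1`, and vertex `1` comes after all others, so the labelling is increasing only up
  -- to a rotation.
  · have hk' : shift m j k = j + m := by
      unfold shift next at *
      split_ifs at * <;> omega
    have hg : ∀ a ∈ Finset.Icc 1 m, 1 ≤ a ∧ a ≤ m ∧
        (a = 1 ∧ glueLabel m j k a = j + m ∨ a ≠ 1 ∧ glueLabel m j k a = j + a - 1) := by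
      intro a ha
      rw [Finset.mem_Icc] at ha
      unfold glueLabel
      split_ifs <;> omega
    refine ⟨fun a ha b hb => ?_, fun a ha b hb c hc d hd => ?_⟩
    · have := hg a ha
      have := hg b hb
      omega
    · obtain ⟨_, _, hga⟩ := hg a ha
      obtain ⟨_, _, hgb⟩ := hg b hb
      obtain ⟨_, _, hgc⟩ := hg c hc
      obtain ⟨_, _, hgd⟩ := hg d hd
      have hlt : ∀ x y, 1 ≤ x → x ≤ m → 1 ≤ y → y ≤ m →
          (x = 1 ∧ glueLabel m j k x = j + m ∨ x ≠ 1 ∧ glueLabel m j k x = j + x - 1) →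
          (y = 1 ∧ glueLabel m j k y = j + m ∨ y ≠ 1 ∧ glueLabel m j k y = j + y - 1) →
          (glueLabel m j k x < glueLabel m j k y ↔ x ≠ 1 ∧ (y = 1 ∨ x < y)) := by
        omega
      simp only [Crosses, Cross, min_lt_iff, lt_max_iff, lt_min_iff, max_lt_iff]
      rw [hlt a c, hlt a d, hlt b c, hlt b d, hlt c a, hlt c b, hlt d a, hlt d b] <;>
        try assumption
      exact crosses_rotate (by omega) (by omega) (by omega) (by omega)

section Gluing

variable {n m j k l r : ℕ} {S T : Finset (Sym2 ℕ)}

theorem isSide_iff {a b : ℕ} (ha : a ∈ Finset.Icc 1 n) (hb : b ∈ Finset.Icc 1 n) :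
    IsSide n a b ↔ (b = a + 1 ∨ a = n ∧ b = 1) ∨ (a = b + 1 ∨ b = n ∧ a = 1) := by
  rw [Finset.mem_Icc] at ha hb
  unfold IsSide next
  split_ifs <;> omega

theorem isSide_iff_consecutive {a b : ℕ} (ha : a ∈ Finset.Icc 1 n) (hb : b ∈ Finset.Icc 1 n)
    (hab : a ≠ b) : IsSide n a b ↔ Consecutive (Finset.Icc 1 n) a b := by
  constructor
  · exact fun h => consecutive_iff.2 fun c hc d hd => h.not_cross ha hb hc hd
  · intro h
    rcases lt_or_gt_of_ne hab with hlt | hlt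
    · exact isSide_of_consecutive ha hb hlt h
    · exact (isSide_of_consecutive hb ha hlt (consecutive_comm.1 h)).symm

/-- A cyclic embedding reflects sides. -/
theorem IsCyclicEmbedding.isSide {f : ℕ → ℕ} {N : ℕ} (hf : IsCyclicEmbedding f (Finset.Icc 1 n))
    (hN : (Finset.Icc 1 n).image f ⊆ Finset.Icc 1 N) {a b : ℕ} (ha : a ∈ Finset.Icc 1 n)
    (hb : b ∈ Finset.Icc 1 n) (hab : a ≠ b) (h : IsSide N (f a) (f b)) : IsSide n a b := by
  have hfa := Finset.mem_image_of_mem f ha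
  have hfb := Finset.mem_image_of_mem f hb
  -- A side is a chord that no chord between vertices crosses, and restricting to the image leaves
  -- fewer chords. The converse fails: the sides at which the polygons are glued become diagonals.
  rw [isSide_iff_consecutive (hN hfa) (hN hfb) fun h => hab (hf.injOn a ha b hb h),
    consecutive_iff] at h
  rw [isSide_iff_consecutive ha hb hab, ← hf.consecutive_image subset_rfl ha hb, consecutive_iff]
  exact fun c hc d hd => h c (hN hc) d (hN hd)

theorem shift_cases (m j x : ℕ) :
    x ≤ j ∧ shift m j x = x ∨ j < x ∧ shift m j x = x + (m - 1) := by
  unfold shift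
  split_ifs <;> omega

theorem glueLabel_cases (m j k x : ℕ) :
    x = 1 ∧ glueLabel m j k x = shift m j k ∨ x ≠ 1 ∧ glueLabel m j k x = j + x - 1 := by
  unfold glueLabel
  split_ifs <;> omega

/-- The positions of the vertices of the new triangle. -/
theorem IsGluing.corners (h : IsGluing n m j k l r) :
    1 ≤ k ∧ k ≤ n ∧ 1 ≤ l ∧ l ≤ n ∧ 2 ≤ r ∧ r ≤ m ∧ 1 ≤ j ∧ j ≤ n ∧ 3 ≤ n ∧ 3 ≤ m ∧
    (j < n ∧ (k = j ∧ l = j + 1 ∧ r = m ∧ shift m j k = j ∧ shift m j l = j + m ∧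
        glueLabel m j k r = j + m - 1 ∨
      k = j + 1 ∧ l = j ∧ r = 2 ∧ shift m j k = j + m ∧ shift m j l = j ∧
        glueLabel m j k r = j + 1) ∨
    j = n ∧ (k = j ∧ l = 1 ∧ r = m ∧ shift m j k = n ∧ shift m j l = 1 ∧
        glueLabel m j k r = n + m - 1 ∨
      k = 1 ∧ l = j ∧ r = 2 ∧ shift m j k = 1 ∧ shift m j l = n ∧
        glueLabel m j k r = n + 1)) := by
  obtain ⟨h1, h2, h3, h4, h5⟩ := h
  by_cases hjn : j = n
  · have hnext : next n j = 1 := by simp [next, hjn]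
    rw [hnext] at h5
    rcases h5 with ⟨rfl, rfl, rfl⟩ | ⟨rfl, rfl, rfl⟩
    · have hk := shift_cases r k k
      have hl := shift_cases r k 1
      have hr := glueLabel_cases r k k r
      refine ⟨by omega, by omega, by omega, by omega, by omega, by omega, by omega, by omega,
        by omega, by omega,
        Or.inr ⟨by omega, Or.inl ⟨rfl, rfl, rfl, ?_, ?_, ?_⟩⟩⟩ <;> omega
    · have hk := shift_cases m l 1
      have hl := shift_cases m l l
      have hr := glueLabel_cases m l 1 2
      refine ⟨by omega, by omega, by omega, by omega, by omega, by omega, by omega, by omega,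
        by omega, by omega,
        Or.inr ⟨by omega, Or.inr ⟨rfl, rfl, rfl, ?_, ?_, ?_⟩⟩⟩ <;> omega
  · have hnext : next n j = j + 1 := by simp [next, hjn]
    rw [hnext] at h5
    rcases h5 with ⟨rfl, rfl, rfl⟩ | ⟨rfl, rfl, rfl⟩
    · have hk := shift_cases r k k
      have hl := shift_cases r k (k + 1)
      have hr := glueLabel_cases r k k r
      refine ⟨by omega, by omega, by omega, by omega, by omega, by omega, by omega, by omega,
        by omega, by omega,
        Or.inl ⟨by omega, Or.inl ⟨rfl, rfl, rfl, ?_, ?_, ?_⟩⟩⟩ <;> omega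
    · have hk := shift_cases m l (l + 1)
      have hl := shift_cases m l l
      have hr := glueLabel_cases m l (l + 1) 2
      refine ⟨by omega, by omega, by omega, by omega, by omega, by omega, by omega, by omega,
        by omega, by omega,
        Or.inl ⟨by omega, Or.inr ⟨rfl, rfl, rfl, ?_, ?_, ?_⟩⟩⟩ <;> omega

theorem IsGluing.mem_image_shift (h : IsGluing n m j k l r) {x : ℕ} :
    x ∈ (Finset.Icc 1 n).image (shift m j) ↔
      1 ≤ x ∧ x ≤ n + m - 1 ∧ (x ≤ j ∨ j + m ≤ x) := by
  have h' := h.corners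
  rw [Finset.mem_image]
  constructor
  · rintro ⟨a, ha, rfl⟩
    rw [Finset.mem_Icc] at ha
    have := shift_cases m j a
    omega
  · rintro ⟨h1, h2, h3⟩
    by_cases hx : x ≤ j
    · refine ⟨x, Finset.mem_Icc.2 (by omega), ?_⟩
      have := shift_cases m j x
      omega
    · refine ⟨x - (m - 1), Finset.mem_Icc.2 (by omega), ?_⟩
      have := shift_cases m j (x - (m - 1))
      omega

theorem IsGluing.mem_image_glueLabel (h : IsGluing n m j k l r) {x : ℕ} :
    x ∈ (Finset.Icc 1 m).image (glueLabel m j k) ↔ (j < x ∧ x < j + m) ∨ x = shift m j k := by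
  have h' := h.corners
  rw [Finset.mem_image]
  constructor
  · rintro ⟨a, ha, rfl⟩
    rw [Finset.mem_Icc] at ha
    have := glueLabel_cases m j k a
    omega
  · intro hx
    by_cases hk : x = shift m j k
    · refine ⟨1, Finset.mem_Icc.2 (by omega), ?_⟩
      have := glueLabel_cases m j k 1
      omega
    · refine ⟨x + 1 - j, Finset.mem_Icc.2 (by omega), ?_⟩
      have := glueLabel_cases m j k (x + 1 - j)
      omega

theorem IsGluing.image_shift_subset (h : IsGluing n m j k l r) :
    (Finset.Icc 1 n).image (shift m j) ⊆ Finset.Icc 1 (n + m - 1) := fun x hx => by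
  rw [h.mem_image_shift] at hx
  exact Finset.mem_Icc.2 ⟨hx.1, hx.2.1⟩

theorem IsGluing.image_glueLabel_subset (h : IsGluing n m j k l r) :
    (Finset.Icc 1 m).image (glueLabel m j k) ⊆ Finset.Icc 1 (n + m - 1) := fun x hx => by
  rw [h.mem_image_glueLabel] at hx
  have h' := h.corners
  rw [Finset.mem_Icc]
  omega

theorem mem_image_map {D : Finset (Sym2 ℕ)} {f : ℕ → ℕ} {x y : ℕ} :
    s(x, y) ∈ D.image (Sym2.map f) ↔ ∃ a b, s(a, b) ∈ D ∧ x = f a ∧ y = f b := by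
  rw [Finset.mem_image]
  constructor
  · rintro ⟨z, hz, hzx⟩
    induction z with
    | _ a b =>
      rw [Sym2.map_mk, Sym2.eq_iff] at hzx
      rcases hzx with ⟨h1, h2⟩ | ⟨h1, h2⟩
      · exact ⟨a, b, hz, h1.symm, h2.symm⟩
      · exact ⟨b, a, by rwa [Sym2.eq_swap], h2.symm, h1.symm⟩
  · rintro ⟨a, b, h, rfl, rfl⟩
    exact ⟨_, h, rfl⟩

theorem mem_glue {x y : ℕ} : s(x, y) ∈ glue m j k l r S T ↔
    (∃ a b, s(a, b) ∈ S ∧ x = shift m j a ∧ y = shift m j b) ∨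
    (∃ a b, s(a, b) ∈ T ∧ x = glueLabel m j k a ∧ y = glueLabel m j k b) ∨
    ((x = shift m j k ∧ y = shift m j l ∨ x = shift m j l ∧ y = shift m j k) ∨
      (x = shift m j k ∧ y = glueLabel m j k r ∨ x = glueLabel m j k r ∧ y = shift m j k)) := by
  have h1 : glueLabel m j k 1 = shift m j k := by simp [glueLabel]
  simp only [glue, Finset.mem_union, mem_image_map, Finset.mem_insert, Finset.mem_singleton,
    Sym2.eq_iff, h1, or_assoc]

/-- The side `kl` stops being a side but is restored as one of the two new diagonals. Nothing else
is added between old vertices: the image of the `m`-gon meets that of the `n`-gon in one vertex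
only. -/
theorem IsGluing.edge_shift (h : IsGluing n m j k l r) (hT : IsDissection m T) {a b : ℕ}
    (ha : a ∈ Finset.Icc 1 n) (hb : b ∈ Finset.Icc 1 n) (hab : a ≠ b) :
    Edge (n + m - 1) (glue m j k l r S T) (shift m j a) (shift m j b) ↔ Edge n S a b := by
  have inj : ∀ x y, shift m j x = shift m j y → x = y :=
    fun x y => (shift_strictMono m j).injective.eq_iff.1
  have hfa := Finset.mem_image_of_mem (shift m j) ha
  have hfb := Finset.mem_image_of_mem (shift m j) hb
  have hne : shift m j a ≠ shift m j b := fun h => hab (inj _ _ h)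
  have hkl : IsSide n k l := by
    rcases h.cases with ⟨rfl, rfl, -⟩ | ⟨rfl, rfl, -⟩
    · exact Or.inl rfl
    · exact Or.inr rfl
  unfold Edge
  rw [mem_glue]
  constructor
  · rintro (hs | ⟨x, y, hxy, hx, hy⟩ | ⟨x, y, hxy, hx, hy⟩ | (⟨h1, h2⟩ | ⟨h1, h2⟩) | hc)
    · exact Or.inl ((isCyclicEmbedding_shift m j _).isSide h.image_shift_subset ha hb hab hs)
    · rw [inj _ _ hx, inj _ _ hy]
      exact Or.inr hxy
    · have hd := hT.diagonal x y hxy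
      have hgx := Finset.mem_image_of_mem (glueLabel m j k) hd.1
      have hgy := Finset.mem_image_of_mem (glueLabel m j k) hd.2.1
      rw [h.mem_image_glueLabel] at hgx hgy
      rw [h.mem_image_shift] at hfa hfb
      omega
    · rw [inj _ _ h1, inj _ _ h2]
      exact Or.inl hkl
    · rw [inj _ _ h1, inj _ _ h2]
      exact Or.inl hkl.symm
    · rw [h.mem_image_shift] at hfa hfb
      have h' := h.corners
      omega
  · rintro (hs | hab')
    · by_cases hkl : (a = k ∧ b = l) ∨ (a = l ∧ b = k)
      · right; right; right; left
        rcases hkl with ⟨rfl, rfl⟩ | ⟨rfl, rfl⟩ <;> tauto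
      · left
        rw [isSide_iff ha hb] at hs
        rw [isSide_iff (h.image_shift_subset hfa) (h.image_shift_subset hfb)]
        rw [Finset.mem_Icc] at ha hb
        have h' := h.corners
        have hca := shift_cases m j a
        have hcb := shift_cases m j b
        clear hfa hfb inj hne h
        -- The excluded side `kl` is `{j, next n j}`, the only one into which new vertices are
        -- inserted: `{j, j + 1}` if `j < n`, and `{n, 1}` if `j = n`.
        have hjl : (a = j ∧ b = j + 1 ∨ a = j + 1 ∧ b = j) → j = n := by omega
        have hjn : j = n → ¬ (a = n ∧ b = 1 ∨ a = 1 ∧ b = n) := by omega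
        clear hkl
        have hm : 3 ≤ m := by omega
        have hjn' : 1 ≤ j ∧ j ≤ n := by omega
        clear h'
        rcases hca with ⟨_, hca⟩ | ⟨_, hca⟩ <;> rcases hcb with ⟨_, hcb⟩ | ⟨_, hcb⟩ <;>
          rw [hca, hcb] <;> clear hca hcb <;> omega
    · exact Or.inr (Or.inl ⟨a, b, hab', rfl, rfl⟩)

theorem IsGluing.edge_glueLabel (h : IsGluing n m j k l r) (hS : IsDissection n S)
    (hT : IsDissection m T) {a b : ℕ}
    (ha : a ∈ Finset.Icc 1 m) (hb : b ∈ Finset.Icc 1 m) (hab : a ≠ b) :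
    Edge (n + m - 1) (glue m j k l r S T) (glueLabel m j k a) (glueLabel m j k b) ↔
      Edge m T a b := by
  have inj := h.isCyclicEmbedding_glueLabel.injOn
  have hne : glueLabel m j k a ≠ glueLabel m j k b := fun h => hab (inj a ha b hb h)
  have hga := Finset.mem_image_of_mem (glueLabel m j k) ha
  have hgb := Finset.mem_image_of_mem (glueLabel m j k) hb
  have h' := h.corners
  have h1m : 1 ∈ Finset.Icc 1 m := Finset.mem_Icc.2 (by omega)
  have hrm : r ∈ Finset.Icc 1 m := Finset.mem_Icc.2 (by omega)
  have h1 : glueLabel m j k 1 = shift m j k := by simp [glueLabel]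
  have h1r : IsSide m 1 r := by
    rw [isSide_iff h1m hrm]
    omega
  unfold Edge
  rw [mem_glue]
  constructor
  · rintro (hs | ⟨x, y, hxy, hx, hy⟩ | ⟨x, y, hxy, hx, hy⟩ | hc | (⟨h2, h3⟩ | ⟨h2, h3⟩))
    · exact Or.inl (h.isCyclicEmbedding_glueLabel.isSide h.image_glueLabel_subset ha hb hab hs)
    · have hd := hS.diagonal x y hxy
      have hfx := Finset.mem_image_of_mem (shift m j) hd.1
      have hfy := Finset.mem_image_of_mem (shift m j) hd.2.1
      rw [h.mem_image_glueLabel] at hga hgb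
      rw [h.mem_image_shift] at hfx hfy
      omega
    · have := hT.diagonal x y hxy
      rw [inj _ ha _ this.1 hx, inj _ hb _ this.2.1 hy]
      exact Or.inr hxy
    · rw [h.mem_image_glueLabel] at hga hgb
      omega
    · rw [← h1] at h2
      rw [inj _ ha _ h1m h2, inj _ hb _ hrm h3]
      exact Or.inl h1r
    · rw [← h1] at h3
      rw [inj _ ha _ hrm h2, inj _ hb _ h1m h3]
      exact Or.inl h1r.symm
  · rintro (hs | hab')
    · by_cases hkl : (a = 1 ∧ b = r) ∨ (a = r ∧ b = 1)
      · right; right; right; right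
        rcases hkl with ⟨rfl, rfl⟩ | ⟨rfl, rfl⟩ <;> tauto
      · left
        rw [isSide_iff ha hb] at hs
        rw [isSide_iff (h.image_glueLabel_subset hga) (h.image_glueLabel_subset hgb)]
        rw [Finset.mem_Icc] at ha hb
        have hca := glueLabel_cases m j k a
        have hcb := glueLabel_cases m j k b
        clear hga hgb inj hne h h1r hrm h1m h1
        rcases hca with ⟨_, hca⟩ | ⟨_, hca⟩ <;> rcases hcb with ⟨_, hcb⟩ | ⟨_, hcb⟩ <;>
          rw [hca, hcb] <;> clear hca hcb <;> omega
    · exact Or.inr (Or.inr (Or.inl ⟨a, b, hab', rfl, rfl⟩))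

end Gluing

theorem IsDissection.not_crosses {n : ℕ} {D : Finset (Sym2 ℕ)} (hD : IsDissection n D)
    {a b c d : ℕ} (hab : s(a, b) ∈ D) (hcd : s(c, d) ∈ D) : ¬ Crosses a b c d := by
  rintro (h | h)
  · exact hD.not_cross hab hcd h
  · exact hD.not_cross hab (by rwa [Sym2.eq_swap]) h

section Gluing

variable {n m j k l r : ℕ} {S T : Finset (Sym2 ℕ)}

/-! ### The faces of a glued dissection -/

/-- The vertex set of the new triangle. -/
def triangle (m j k l r : ℕ) : Finset ℕ := {shift m j k, shift m j l, glueLabel m j k r}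

theorem mem_triangle {x : ℕ} : x ∈ triangle m j k l r ↔
    x = shift m j k ∨ x = shift m j l ∨ x = glueLabel m j k r := by
  simp [triangle]

theorem IsGluing.corners_ne (h : IsGluing n m j k l r) :
    shift m j k ≠ shift m j l ∧ shift m j k ≠ glueLabel m j k r ∧
      shift m j l ≠ glueLabel m j k r := by
  obtain ⟨-, -, -, -, -, -, hj1, hjn, hn, hm, h'⟩ := h.corners
  rcases h' with ⟨_, ⟨-, -, -, hx, hy, hz⟩ | ⟨-, -, -, hx, hy, hz⟩⟩ |
    ⟨_, ⟨-, -, -, hx, hy, hz⟩ | ⟨-, -, -, hx, hy, hz⟩⟩ <;> rw [hx, hy, hz] <;> omega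

theorem IsGluing.corners_mem (h : IsGluing n m j k l r) :
    shift m j k ∈ Finset.Icc 1 (n + m - 1) ∧ shift m j l ∈ Finset.Icc 1 (n + m - 1) ∧
      glueLabel m j k r ∈ Finset.Icc 1 (n + m - 1) := by
  obtain ⟨-, -, -, -, -, -, hj1, hjn, hn, hm, h'⟩ := h.corners
  simp only [Finset.mem_Icc]
  rcases h' with ⟨_, ⟨-, -, -, hx, hy, hz⟩ | ⟨-, -, -, hx, hy, hz⟩⟩ |
    ⟨_, ⟨-, -, -, hx, hy, hz⟩ | ⟨-, -, -, hx, hy, hz⟩⟩ <;> rw [hx, hy, hz] <;> omega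

theorem IsGluing.isSide_corners (h : IsGluing n m j k l r) :
    IsSide (n + m - 1) (shift m j l) (glueLabel m j k r) := by
  obtain ⟨-, -, -, -, -, -, hj1, hjn, hn, hm, h'⟩ := h.corners
  rw [isSide_iff h.corners_mem.2.1 h.corners_mem.2.2]
  rcases h' with ⟨_, ⟨-, -, -, hx, hy, hz⟩ | ⟨-, -, -, hx, hy, hz⟩⟩ |
    ⟨_, ⟨-, -, -, hx, hy, hz⟩ | ⟨-, -, -, hx, hy, hz⟩⟩ <;> rw [hy, hz] <;> omega

theorem IsGluing.card_triangle (h : IsGluing n m j k l r) : (triangle m j k l r).card = 3 :=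
  Finset.card_eq_three.2 ⟨_, _, _, h.corners_ne.1, h.corners_ne.2.1, h.corners_ne.2.2, rfl⟩

theorem IsGluing.isDissection_glue (h : IsGluing n m j k l r) (hS : IsDissection n S)
    (hT : IsDissection m T) : IsDissection (n + m - 1) (glue m j k l r S T) where
  three_le := by
    have := h.three_le_left
    have := h.three_le_right
    omega
  diagonal x y hxy := by
    rw [mem_glue] at hxy
    rcases hxy with ⟨a, b, hab, rfl, rfl⟩ | ⟨a, b, hab, rfl, rfl⟩ | hc
    · obtain ⟨ha, hb, hne, hs⟩ := hS.diagonal a b hab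
      exact ⟨h.image_shift_subset (Finset.mem_image_of_mem _ ha),
        h.image_shift_subset (Finset.mem_image_of_mem _ hb),
        fun h' => hne ((shift_strictMono m j).injective h'),
        fun h' => hs ((isCyclicEmbedding_shift m j _).isSide h.image_shift_subset ha hb hne h')⟩
    · obtain ⟨ha, hb, hne, hs⟩ := hT.diagonal a b hab
      exact ⟨h.image_glueLabel_subset (Finset.mem_image_of_mem _ ha),
        h.image_glueLabel_subset (Finset.mem_image_of_mem _ hb),
        fun h' => hne (h.isCyclicEmbedding_glueLabel.injOn a ha b hb h'),
        fun h' => hs (h.isCyclicEmbedding_glueLabel.isSide h.image_glueLabel_subset ha hb hne h')⟩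
    · have h' := h.corners
      have hx : x ∈ Finset.Icc 1 (n + m - 1) := Finset.mem_Icc.2 (by omega)
      have hy : y ∈ Finset.Icc 1 (n + m - 1) := Finset.mem_Icc.2 (by omega)
      refine ⟨hx, hy, by omega, ?_⟩
      rw [isSide_iff hx hy]
      omega
  noncrossing x y z w hxy hyz hzw := by
    rintro ⟨hxz, hyw⟩
    have hcr : Crosses x z y w := Or.inl (by unfold Cross; omega)
    have h' := h.corners
    -- Chords from `S` have no end strictly between `j` and `j + m`, while chords from `T` have all
    -- ends there or at the shared vertex. The two images occupy arcs with one common point, so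
    -- mixed pairs do not cross.
    have hA : ∀ a b, s(a, b) ∈ S →
        (shift m j a ≤ j ∨ j + m ≤ shift m j a) ∧ (shift m j b ≤ j ∨ j + m ≤ shift m j b) ∧
        (1 ≤ shift m j a ∧ shift m j a ≤ n + m - 1) ∧
        (1 ≤ shift m j b ∧ shift m j b ≤ n + m - 1) := by
      intro a b hab
      obtain ⟨ha, hb, -⟩ := hS.diagonal a b hab
      have hfa := Finset.mem_image_of_mem (shift m j) ha
      have hfb := Finset.mem_image_of_mem (shift m j) hb
      rw [h.mem_image_shift] at hfa hfb
      exact ⟨hfa.2.2, hfb.2.2, ⟨hfa.1, hfa.2.1⟩, hfb.1, hfb.2.1⟩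
    have hB : ∀ a b, s(a, b) ∈ T →
        (j < glueLabel m j k a ∧ glueLabel m j k a < j + m ∨ glueLabel m j k a = shift m j k) ∧
        (j < glueLabel m j k b ∧ glueLabel m j k b < j + m ∨
          glueLabel m j k b = shift m j k) := by
      intro a b hab
      obtain ⟨ha, hb, -⟩ := hT.diagonal a b hab
      have hfa := Finset.mem_image_of_mem (glueLabel m j k) ha
      have hfb := Finset.mem_image_of_mem (glueLabel m j k) hb
      rw [h.mem_image_glueLabel] at hfa hfb
      exact ⟨hfa, hfb⟩
    rw [mem_glue] at hxz hyw
    rcases hxz with ⟨a, b, hab, rfl, rfl⟩ | ⟨a, b, hab, rfl, rfl⟩ | hc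
    · have hab' := hA a b hab
      rcases hyw with ⟨c, d, hcd, rfl, rfl⟩ | ⟨c, d, hcd, rfl, rfl⟩ | hc'
      · rw [(isCyclicEmbedding_shift m j {a, b, c, d}).crosses _ (by simp) _ (by simp) _
          (by simp) _ (by simp)] at hcr
        exact hS.not_crosses hab hcd hcr
      · have hcd' := hB c d hcd
        omega
      · omega
    · have hab' := hB a b hab
      rcases hyw with ⟨c, d, hcd, rfl, rfl⟩ | ⟨c, d, hcd, rfl, rfl⟩ | hc'
      · have hcd' := hA c d hcd
        omega
      · obtain ⟨ha, hb, -⟩ := hT.diagonal a b hab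
        obtain ⟨hc, hd, -⟩ := hT.diagonal c d hcd
        rw [h.isCyclicEmbedding_glueLabel.crosses _ ha _ hb _ hc _ hd] at hcr
        exact hT.not_crosses hab hcd hcr
      · omega
    · rcases hyw with ⟨c, d, hcd, rfl, rfl⟩ | ⟨c, d, hcd, rfl, rfl⟩ | hc'
      · have hcd' := hA c d hcd
        omega
      · have hcd' := hB c d hcd
        omega
      · omega

theorem IsPlanar.face_subset_side {E : ℕ → ℕ → Prop} {V P : Finset ℕ} (hV : IsPlanar E V)
    (hP : IsFace E P) (hPV : P ⊆ V) {a b : ℕ} (ha : a ∈ V) (hb : b ∈ V) (hab : a ≠ b)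
    (hE : E a b) :
    (∀ x ∈ P, min a b ≤ x ∧ x ≤ max a b) ∨ (∀ x ∈ P, x ≤ min a b ∨ max a b ≤ x) := by
  rcases lt_or_gt_of_ne hab with h | h
  · rw [min_eq_left h.le, max_eq_right h.le]
    exact hP.subset_side h hE fun c hc d hd => hV.noncrossing a ha b hb c (hPV hc) d (hPV hd) hE
  · rw [min_eq_right h.le, max_eq_left h.le]
    have hE' := hV.symm _ _ hE
    exact hP.subset_side h hE' fun c hc d hd => hV.noncrossing b hb a ha c (hPV hc) d (hPV hd) hE'

theorem IsGluing.isFace_triangle (h : IsGluing n m j k l r) :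
    IsFace (Edge (n + m - 1) (glue m j k l r S T)) (triangle m j k l r) := by
  refine ⟨h.card_triangle.ge, ?_⟩
  intro a ha b hb hab
  have hcons : Consecutive (triangle m j k l r) a b := by
    rw [consecutive_iff]
    intro c hc d hd hx
    have hne := hx.ne
    clear hx h
    rw [mem_triangle] at ha hb hc hd
    rcases ha with rfl | rfl | rfl <;> rcases hb with rfl | rfl | rfl <;>
      rcases hc with rfl | rfl | rfl <;> rcases hd with rfl | rfl | rfl <;> tauto
  refine iff_of_true ?_ hcons
  have hYZ := h.isSide_corners
  rw [mem_triangle] at ha hb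
  unfold Edge
  rw [mem_glue]
  rcases ha with rfl | rfl | rfl <;> rcases hb with rfl | rfl | rfl <;>
    first | exact absurd rfl hab | exact Or.inl hYZ | exact Or.inl hYZ.symm | tauto

/-- By `IsPlanar.face_subset_side` a face straddles neither of the two new diagonals, and these cut
the polygon into the two images and the triangle. The triangle has too few vertices to contain any
face but itself. -/
theorem IsGluing.faces_glue (h : IsGluing n m j k l r) (hS : IsDissection n S)
    (hT : IsDissection m T) :
    faces (Edge (n + m - 1) (glue m j k l r S T)) (Finset.Icc 1 (n + m - 1)) =
      faces (Edge (n + m - 1) (glue m j k l r S T)) ((Finset.Icc 1 n).image (shift m j)) ∪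
      faces (Edge (n + m - 1) (glue m j k l r S T)) ((Finset.Icc 1 m).image (glueLabel m j k)) ∪
      {triangle m j k l r} := by
  obtain ⟨hX, hY, hZ⟩ := h.corners_mem
  have hV := (h.isDissection_glue hS hT).isPlanar
  ext P
  simp only [Finset.mem_union, Finset.mem_singleton, mem_faces, ← or_and_right]
  constructor
  · rintro ⟨hPV, hP⟩
    have h1 := hV.face_subset_side hP hPV hX hY h.corners_ne.1
      (Or.inr (mem_glue.2 (Or.inr (Or.inr (Or.inl (Or.inl ⟨rfl, rfl⟩))))))
    have h2 := hV.face_subset_side hP hPV hX hZ h.corners_ne.2.1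
      (Or.inr (mem_glue.2 (Or.inr (Or.inr (Or.inr (Or.inl ⟨rfl, rfl⟩))))))
    have key : P ⊆ (Finset.Icc 1 n).image (shift m j) ∨
        P ⊆ (Finset.Icc 1 m).image (glueLabel m j k) ∨ P ⊆ triangle m j k l r := by
      have hIcc : ∀ x ∈ P, 1 ≤ x ∧ x ≤ n + m - 1 := fun x hx => Finset.mem_Icc.1 (hPV hx)
      simp only [Finset.subset_iff, h.mem_image_shift, h.mem_image_glueLabel, mem_triangle]
      obtain ⟨-, -, -, -, -, -, hj1, hjn, hn, hm, h'⟩ := h.corners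
      clear hV hP hPV h hS hT hX hY hZ
      have key : ((∀ x ∈ P, x ≤ j ∨ j + m ≤ x) ∨
          (∀ x ∈ P, j < x ∧ x < j + m ∨ x = shift m j k) ∨
          (∀ x ∈ P, x = shift m j k ∨ x = shift m j l ∨ x = glueLabel m j k r)) := by
        -- For `j < n` the first new diagonal is `{j, j + m}`, with the `n`-gon on its outer side;
        -- for `j = n` it is `{1, n}`, with the `n`-gon on its inner side.
        rcases h' with ⟨hj, ⟨-, -, -, hx, hy, hz⟩ | ⟨-, -, -, hx, hy, hz⟩⟩ |
          ⟨hj, ⟨-, -, -, hx, hy, hz⟩ | ⟨-, -, -, hx, hy, hz⟩⟩ <;>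
        rw [hx, hy] at h1 <;> rw [hx, hz] at h2 <;> rw [hx, hy, hz] <;> clear hx hy hz
        · rcases h1 with h1 | h1
          · rcases h2 with h2 | h2
            · exact Or.inr (Or.inl fun x hx => by have := h2 x hx; omega)
            · exact Or.inr (Or.inr fun x hx => by have := h1 x hx; have := h2 x hx; omega)
          · exact Or.inl fun x hx => by have := h1 x hx; omega
        · rcases h1 with h1 | h1
          · rcases h2 with h2 | h2
            · exact Or.inr (Or.inl fun x hx => by have := h2 x hx; omega)
            · exact Or.inr (Or.inr fun x hx => by have := h1 x hx; have := h2 x hx; omega)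
          · exact Or.inl fun x hx => by have := h1 x hx; omega
        · rcases h1 with h1 | h1
          · exact Or.inl fun x hx => by have := h1 x hx; omega
          · rcases h2 with h2 | h2
            · exact Or.inr (Or.inl fun x hx => by
                have := h2 x hx; have := hIcc x hx; omega)
            · exact Or.inr (Or.inr fun x hx => by
                have := h1 x hx; have := h2 x hx; have := hIcc x hx; omega)
        · rcases h1 with h1 | h1
          · exact Or.inl fun x hx => by have := h1 x hx; omega
          · rcases h2 with h2 | h2
            · exact Or.inr (Or.inr fun x hx => by
                have := h1 x hx; have := h2 x hx; have := hIcc x hx; omega)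
            · exact Or.inr (Or.inl fun x hx => by
                have := h1 x hx; have := h2 x hx; have := hIcc x hx; omega)
      exact key.imp (fun h x hx => ⟨(hIcc x hx).1, (hIcc x hx).2, h x hx⟩) id
    rcases key with hk | hk | hk
    · exact Or.inl ⟨Or.inl hk, hP⟩
    · exact Or.inl ⟨Or.inr hk, hP⟩
    · refine Or.inr (Finset.eq_of_subset_of_card_le hk (le_trans ?_ hP.1))
      exact Finset.card_le_three
  · rintro (⟨hP | hP, hF⟩ | rfl)
    · exact ⟨hP.trans h.image_shift_subset, hF⟩
    · exact ⟨hP.trans h.image_glueLabel_subset, hF⟩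
    · refine ⟨fun x hx => ?_, h.isFace_triangle⟩
      rcases mem_triangle.1 hx with rfl | rfl | rfl <;> assumption

/-- Stated for any predicate so that it serves both for the parity of `P.card` and for incidence
with a given vertex. -/
theorem IsGluing.card_filter_faces (h : IsGluing n m j k l r) (hS : IsDissection n S)
    (hT : IsDissection m T) (p : Finset ℕ → Prop) [DecidablePred p] :
    ((faces (Edge (n + m - 1) (glue m j k l r S T)) (Finset.Icc 1 (n + m - 1))).filter p).card =
      ((faces (Edge (n + m - 1) (glue m j k l r S T))
        ((Finset.Icc 1 n).image (shift m j))).filter p).card +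
      ((faces (Edge (n + m - 1) (glue m j k l r S T))
        ((Finset.Icc 1 m).image (glueLabel m j k))).filter p).card +
      if p (triangle m j k l r) then 1 else 0 := by
  have h' := h.corners
  have hAB : ∀ P ⊆ (Finset.Icc 1 n).image (shift m j),
      P ⊆ (Finset.Icc 1 m).image (glueLabel m j k) → P.card ≤ 1 := by
    intro P h1 h2
    refine Finset.card_le_one.2 fun a ha b hb => ?_
    have ha1 := h.mem_image_shift.1 (h1 ha)
    have ha2 := h.mem_image_glueLabel.1 (h2 ha)
    have hb1 := h.mem_image_shift.1 (h1 hb)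
    have hb2 := h.mem_image_glueLabel.1 (h2 hb)
    omega
  rw [h.faces_glue hS hT, Finset.filter_union, Finset.filter_union, Finset.card_union_of_disjoint,
    Finset.card_union_of_disjoint, Finset.filter_singleton]
  · split_ifs <;> simp
  · refine Finset.disjoint_filter_filter (Finset.disjoint_left.2 fun P h1 h2 => ?_)
    rw [mem_faces] at h1 h2
    have := hAB P h1.1 h2.1
    have := h1.2.1
    omega
  · rw [← Finset.filter_union]
    refine Finset.disjoint_filter_filter (Finset.disjoint_left.2 fun P h1 h2 => ?_)
    rw [Finset.mem_singleton] at h2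
    subst h2
    rw [Finset.mem_union, mem_faces, mem_faces] at h1
    -- The triangle lies in neither image: the corner from `r` is not in the first, the corner from
    -- `l` not in the second.
    rcases h1 with h1 | h1
    · have := h.mem_image_shift.1 (h1.1 (mem_triangle.2 (Or.inr (Or.inr rfl))))
      omega
    · have := h.mem_image_glueLabel.1 (h1.1 (mem_triangle.2 (Or.inr (Or.inl rfl))))
      omega

theorem IsGluing.index_glue (h : IsGluing n m j k l r) (hS : IsDissection n S)
    (hT : IsDissection m T) :
    index (n + m - 1) (glue m j k l r S T) = index n S + index m T := by
  simp only [index_eq]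
  rw [evenFaces, h.card_filter_faces hS hT, h.card_triangle, if_neg (by decide), add_zero]
  exact congrArg₂ (· + ·)
    ((isCyclicEmbedding_shift m j _).evenFaces_image fun a ha b hb => h.edge_shift hT ha hb)
    (h.isCyclicEmbedding_glueLabel.evenFaces_image fun a ha b hb => h.edge_glueLabel hS hT ha hb)

theorem IsGluing.is3dDissection_glue (h : IsGluing n m j k l r) (hS : Is3dDissection n S)
    (hT : Is3dDissection m T) : Is3dDissection (n + m - 1) (glue m j k l r S T) := by
  refine ⟨h.isDissection_glue hS.1 hT.1, fun P hP => ?_⟩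
  have hS3 := hS.2
  have hT3 := hT.2
  rw [subPolygons_eq_faces] at hS3 hT3
  rw [subPolygons_eq_faces, h.faces_glue hS.1 hT.1,
    (isCyclicEmbedding_shift m j _).faces_image fun a ha b hb => h.edge_shift hT.1 ha hb,
    h.isCyclicEmbedding_glueLabel.faces_image fun a ha b hb => h.edge_glueLabel hS.1 hT.1 ha hb,
    Finset.mem_union, Finset.mem_union, Finset.mem_image, Finset.mem_image,
    Finset.mem_singleton] at hP
  rcases hP with (⟨Q, hQ, rfl⟩ | ⟨Q, hQ, rfl⟩) | rfl
  · rw [(isCyclicEmbedding_shift m j _).card_image (mem_faces.1 hQ).1]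
    exact hS3 Q hQ
  · rw [h.isCyclicEmbedding_glueLabel.card_image (mem_faces.1 hQ).1]
    exact hT3 Q hQ
  · rw [h.card_triangle]

/-! ### The quiddity sequence of a glued dissection -/

/-- The number of sub-polygons at vertex `i`. -/
noncomputable def quid (n : ℕ) (D : Finset (Sym2 ℕ)) (i : ℕ) : ℕ :=
  vertexDegree (Edge n D) (Finset.Icc 1 n) i

theorem IsGluing.quid_shift (h : IsGluing n m j k l r) (hS : IsDissection n S)
    (hT : IsDissection m T) {i : ℕ} (hi : i ∈ Finset.Icc 1 n) :
    quid (n + m - 1) (glue m j k l r S T) (shift m j i) =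
      quid n S i + (if i = k then quid m T 1 + 1 else 0) + (if i = l then 1 else 0) := by
  have hm := h.three_le_right
  have hZ : j < glueLabel m j k r ∧ glueLabel m j k r < j + m := by
    have h' := h.corners
    omega
  have hkl := h.corners_ne.1
  have h1 : glueLabel m j k 1 = shift m j k := by simp [glueLabel]
  have hfi := h.mem_image_shift.1 (Finset.mem_image_of_mem (shift m j) hi)
  have inj := (shift_strictMono m j).injective
  have hA := (isCyclicEmbedding_shift m j _).vertexDegree_image
    (fun a ha b hb => h.edge_shift (S := S) hT ha hb) hi
  have hB := h.isCyclicEmbedding_glueLabel.vertexDegree_image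
    (fun a ha b hb => h.edge_glueLabel hS hT ha hb) (i := 1) (Finset.mem_Icc.2 (by omega))
  unfold quid
  rw [vertexDegree, h.card_filter_faces hS hT]
  change vertexDegree _ _ _ + vertexDegree _ _ _ + _ = _
  rw [hA]
  by_cases hik : i = k
  · subst hik
    rw [if_pos (mem_triangle.2 (Or.inl rfl)), if_pos rfl, if_neg fun hil => hkl (by rw [← hil]),
      ← h1, hB]
    omega
  · have hne : shift m j i ≠ shift m j k := fun h => hik (inj h)
    rw [vertexDegree_eq_zero (V := Finset.image _ (Finset.Icc 1 m))
      (by rw [h.mem_image_glueLabel]; omega), if_neg hik]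
    have : shift m j i ∈ triangle m j k l r ↔ i = l := by
      rw [mem_triangle]
      constructor
      · rintro (h | h | h)
        · exact absurd h hne
        · exact inj h
        · omega
      · rintro rfl
        tauto
    simp only [this]

/-- Vertex `1` of the second polygon is left out: it is the shared vertex, counted in
`IsGluing.quid_shift`. -/
theorem IsGluing.quid_glueLabel (h : IsGluing n m j k l r) (hS : IsDissection n S)
    (hT : IsDissection m T) {i : ℕ} (hi : 2 ≤ i) (him : i ≤ m) :
    quid (n + m - 1) (glue m j k l r S T) (j + i - 1) =
      quid m T i + (if i = r then 1 else 0) := by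
  have h' := h.corners
  have hi' : i ∈ Finset.Icc 1 m := Finset.mem_Icc.2 (by omega)
  have hgi : glueLabel m j k i = j + i - 1 := by
    have := glueLabel_cases m j k i
    omega
  have hB := h.isCyclicEmbedding_glueLabel.vertexDegree_image
    (fun a ha b hb => h.edge_glueLabel hS hT ha hb) hi'
  unfold quid
  rw [vertexDegree, h.card_filter_faces hS hT]
  change vertexDegree _ _ _ + vertexDegree _ _ _ + _ = _
  rw [← hgi, hB, vertexDegree_eq_zero (V := Finset.image _ (Finset.Icc 1 n))
      (by rw [h.mem_image_shift]; omega), zero_add]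
  have : glueLabel m j k i ∈ triangle m j k l r ↔ i = r := by
    have := glueLabel_cases m j k r
    rw [mem_triangle]
    omega
  simp only [this]

end Gluing

/-- The quiddity sequence of a glued dissection in terms of those of its parts. -/
def glueSeq (j k l r : ℕ) (s t : List ℕ) : List ℕ :=
  let s' := (s.modify (k - 1) (· + t.headD 0 + 1)).modify (l - 1) (· + 1)
  s'.take j ++ t.tail.modify (r - 2) (· + 1) ++ s'.drop j

theorem length_quiddity (n : ℕ) (D : Finset (Sym2 ℕ)) : (quiddity n D).length = n := by
  simp [quiddity]

theorem quiddity_eq_map_quid (n : ℕ) (D : Finset (Sym2 ℕ)) :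
    quiddity n D = (List.range' 1 n).map (quid n D) := quiddity_eq n D

section Gluing

variable {n m j k l r : ℕ} {S T : Finset (Sym2 ℕ)}

theorem IsGluing.quiddity_glue (h : IsGluing n m j k l r) (hS : IsDissection n S)
    (hT : IsDissection m T) :
    quiddity (n + m - 1) (glue m j k l r S T) =
      glueSeq j k l r (quiddity n S) (quiddity m T) := by
  obtain ⟨hk1, hkn, hl1, hln, hr2, hrm, hj1, hjn, hn, hm, -⟩ := h.corners
  have hhead : (quiddity m T).headD 0 = quid m T 1 := by
    obtain ⟨m', rfl⟩ : ∃ m', m = m' + 1 := ⟨m - 1, by omega⟩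
    rw [quiddity_eq_map_quid, List.range'_succ]
    rfl
  have hget : ∀ n D i (hi : i < (quiddity n D).length), (quiddity n D)[i] = quid n D (i + 1) := by
    intro n D i hi
    simp only [quiddity_eq_map_quid, List.getElem_map, List.getElem_range']
    congr 1
    omega
  have hs' : ∀ i (_ : i < n) (hi' : i < (((quiddity n S).modify (k - 1)
      (· + quid m T 1 + 1)).modify (l - 1) (· + 1)).length),
      (((quiddity n S).modify (k - 1) (· + quid m T 1 + 1)).modify (l - 1) (· + 1))[i] =
      quid (n + m - 1) (glue m j k l r S T) (shift m j (i + 1)) := by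
    intro i hi hi'
    rw [h.quid_shift hS hT (Finset.mem_Icc.2 (by omega)), List.getElem_modify,
      List.getElem_modify, hget]
    split_ifs <;> omega
  apply List.ext_getElem
  · simp only [glueSeq, List.length_append, List.length_take, List.length_drop,
      List.length_modify, List.length_tail, length_quiddity]
    omega
  intro i hi hi'
  rw [length_quiddity] at hi
  rw [hget]
  simp only [glueSeq, hhead, List.getElem_append, List.length_append, List.length_take,
    List.length_modify, List.length_tail, length_quiddity, List.getElem_take, List.getElem_drop]
  split_ifs with h1 h2
  · rw [hs' i (by omega), shift, if_pos (by omega)]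
  · rw [List.getElem_modify, List.getElem_tail, hget]
    -- Position `i - j` in the tail belongs to vertex `i - j + 2`: one step for the removed head and
    -- one for counting from `0`.
    rw [show i + 1 = j + (i - j + 2) - 1 by omega,
      h.quid_glueLabel hS hT (by omega) (by omega), min_eq_left hjn,
      show i - j + 1 + 1 = i - j + 2 by omega]
    split_ifs <;> omega
  · rw [hs' _ (by omega), shift, if_neg (by omega)]
    congr 1
    omega

theorem IsGluing.solution_glue (h : IsGluing n m j k l r) (hS : Is3dDissection n S)
    (hT : Is3dDissection m T) (heven : Even (index n S + index m T)) :
    IsEven3d (n + m - 1) (glue m j k l r S T) ∧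
      index (n + m - 1) (glue m j k l r S T) = index n S + index m T ∧
      quiddity (n + m - 1) (glue m j k l r S T) =
        glueSeq j k l r (quiddity n S) (quiddity m T) ∧
      IsPositiveSolution (n + m - 1) (glueSeq j k l r (quiddity n S) (quiddity m T)) := by
  have hi := h.index_glue hS.1 hT.1
  have hE : IsEven3d (n + m - 1) (glue m j k l r S T) :=
    ⟨h.is3dDissection_glue hS hT, by rwa [hi]⟩
  refine ⟨hE, hi, h.quiddity_glue hS.1 hT.1, ?_⟩
  rw [← h.quiddity_glue hS.1 hT.1]
  exact isPositiveSolution_quiddity hE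

/-- The place of the vertex shared by the two polygons can be read off the glued sequence: there
it differs from every other glued sequence with the vertex of the first polygon in that place. -/
theorem IsGluing.glueSeq_ne (h : IsGluing n m j k l r) {j' k' l' r' : ℕ}
    (h' : IsGluing n m j' k' l' r') (hS : IsDissection n S) (hT : IsDissection m T)
    (hk : k ≠ k') (hs : shift m j k = shift m j' k) :
    glueSeq j k l r (quiddity n S) (quiddity m T) ≠
      glueSeq j' k' l' r' (quiddity n S) (quiddity m T) := by
  intro heq
  rw [← h.quiddity_glue hS hT, ← h'.quiddity_glue hS hT, quiddity_eq_map_quid,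
    quiddity_eq_map_quid, List.map_inj_left] at heq
  have hkm : k ∈ Finset.Icc 1 n := Finset.mem_Icc.2 (by have := h.corners; omega)
  have hp := Finset.mem_Icc.1 (h.corners_mem).1
  have hq := heq (shift m j k) (by rw [List.mem_range'_1]; omega)
  have hm := h.three_le_right
  have hpos : 0 < quid m T 1 :=
    hT.isPlanar.vertexDegree_pos (by simpa using hm) (Finset.mem_Icc.2 (by omega))
  -- The first sequence gains at least t₁ + 1 ≥ 2 here; the second gains at most 1, from the corner
  -- `l'`.
  rw [h.quid_shift hS hT hkm, if_pos rfl, hs, h'.quid_shift hS hT hkm, if_neg hk] at hq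
  split_ifs at hq <;> omega

end Gluing

/-! ### The two products as gluings, and distinctness -/

theorem circ_eq_glue (n m k : ℕ) (S T : Finset (Sym2 ℕ)) :
    circ n m k S T = glue m k k (next n k) m S T := by
  have hk : shift m k k = k := by simp [shift]
  have hg : (fun i => k + i - 1) = glueLabel m k k := by
    funext i
    have := glueLabel_cases m k k i
    omega
  rw [circ, glue, hg, ← congrFun hg 1, ← congrFun hg m, Nat.add_sub_cancel]

theorem bullet_eq_glue (n m k : ℕ) (S T : Finset (Sym2 ℕ)) :
    bullet n m k S T = glue m (prev n k) k (prev n k) 2 S T := by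
  rw [bullet, glue, Sym2.eq_swap (a := shift m (prev n k) (prev n k))]
  rfl

theorem isGluing_circ {n m k : ℕ} (hn : 3 ≤ n) (hm : 3 ≤ m) (hk : 1 ≤ k) (hkn : k ≤ n) :
    IsGluing n m k k (next n k) m :=
  ⟨hn, hm, hk, hkn, Or.inl ⟨rfl, rfl, rfl⟩⟩

theorem isGluing_bullet {n m k : ℕ} (hn : 3 ≤ n) (hm : 3 ≤ m) (hk : 1 ≤ k) (hkn : k ≤ n) :
    IsGluing n m (prev n k) k (prev n k) 2 := by
  refine ⟨hn, hm, ?_, ?_, Or.inr ⟨?_, rfl, rfl⟩⟩ <;> unfold prev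
  · split_ifs <;> omega
  · split_ifs <;> omega
  · unfold next
    split_ifs <;> omega

theorem circSeq_eq_glueSeq (n m k : ℕ) (S T : Finset (Sym2 ℕ)) :
    circSeq k (quiddity n S) (quiddity m T) =
      glueSeq k k (next n k) m (quiddity n S) (quiddity m T) := by
  rw [circSeq, length_quiddity, length_quiddity, glueSeq]

theorem bulletSeq_eq_glueSeq (n m k : ℕ) (S T : Finset (Sym2 ℕ)) :
    bulletSeq k (quiddity n S) (quiddity m T) =
      glueSeq (prev n k) k (prev n k) 2 (quiddity n S) (quiddity m T) := by
  rw [bulletSeq, length_quiddity, glueSeq]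

theorem injOn_of_lt_ne {f : ℕ → List ℕ} {s : Set ℕ}
    (h : ∀ a ∈ s, ∀ b ∈ s, a < b → f a ≠ f b) : Set.InjOn f s := by
  intro a ha b hb hab
  by_contra hne
  rcases lt_or_gt_of_ne hne with hlt | hlt
  · exact h a ha b hb hlt hab
  · exact h b hb a ha hlt hab.symm

theorem injOn_circSeq {n m : ℕ} {S T : Finset (Sym2 ℕ)} (hS : IsDissection n S)
    (hT : IsDissection m T) :
    Set.InjOn (fun k => circSeq k (quiddity n S) (quiddity m T)) (Set.Icc 1 n) := by
  refine injOn_of_lt_ne fun k hk k' hk' hlt => ?_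
  simp only [circSeq_eq_glueSeq]
  refine (isGluing_circ hS.three_le hT.three_le hk.1 hk.2).glueSeq_ne
    (isGluing_circ hS.three_le hT.three_le hk'.1 hk'.2) hS hT hlt.ne ?_
  simp [shift, hlt.le]

theorem injOn_bulletSeq {n m : ℕ} {S T : Finset (Sym2 ℕ)} (hS : IsDissection n S)
    (hT : IsDissection m T) :
    Set.InjOn (fun k => bulletSeq k (quiddity n S) (quiddity m T)) (Set.Icc 1 n) := by
  refine injOn_of_lt_ne fun k hk k' hk' hlt => ?_
  rw [Set.mem_Icc] at hk hk'
  have g := isGluing_bullet hS.three_le hT.three_le hk.1 hk.2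
  have g' := isGluing_bullet hS.three_le hT.three_le hk'.1 hk'.2
  simp only [bulletSeq_eq_glueSeq]
  -- The compared place must hold the same vertex in both gluings. For `k = 1` it is vertex `1`,
  -- which keeps its label; for `1 < k < k'` it is vertex `k'`, which lies after both insertions and
  -- has label `k' + m - 1`.
  by_cases h1 : k = 1
  · refine g.glueSeq_ne g' hS hT hlt.ne ?_
    unfold shift prev
    split_ifs <;> omega
  · refine (g'.glueSeq_ne g hS hT hlt.ne' ?_).symm
    unfold shift prev
    split_ifs <;> omega

end ThreeD

theorem mainTheorem5 (n m : ℕ) (S T : Finset (Sym2 ℕ))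
    (h : (ThreeD.IsEven3d n S ∧ ThreeD.IsEven3d m T) ∨
      (ThreeD.IsOdd3d n S ∧ ThreeD.IsOdd3d m T)) :
    (∀ k ∈ Finset.Icc 1 n,
      (ThreeD.IsEven3d (n + m - 1) (ThreeD.circ n m k S T) ∧
        ThreeD.index (n + m - 1) (ThreeD.circ n m k S T) = ThreeD.index n S + ThreeD.index m T ∧
        ThreeD.quiddity (n + m - 1) (ThreeD.circ n m k S T) =
          ThreeD.circSeq k (ThreeD.quiddity n S) (ThreeD.quiddity m T) ∧
        ThreeD.IsPositiveSolution (n + m - 1)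
          (ThreeD.circSeq k (ThreeD.quiddity n S) (ThreeD.quiddity m T))) ∧
      (ThreeD.IsEven3d (n + m - 1) (ThreeD.bullet n m k S T) ∧
        ThreeD.index (n + m - 1) (ThreeD.bullet n m k S T) = ThreeD.index n S + ThreeD.index m T ∧
        ThreeD.quiddity (n + m - 1) (ThreeD.bullet n m k S T) =
          ThreeD.bulletSeq k (ThreeD.quiddity n S) (ThreeD.quiddity m T) ∧
        ThreeD.IsPositiveSolution (n + m - 1)
          (ThreeD.bulletSeq k (ThreeD.quiddity n S) (ThreeD.quiddity m T)))) ∧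
    Set.InjOn (fun k => ThreeD.circSeq k (ThreeD.quiddity n S) (ThreeD.quiddity m T))
      (Set.Icc 1 n) ∧
    Set.InjOn (fun k => ThreeD.bulletSeq k (ThreeD.quiddity n S) (ThreeD.quiddity m T))
      (Set.Icc 1 n) := by
  obtain ⟨hS, hT, heven⟩ : ThreeD.Is3dDissection n S ∧ ThreeD.Is3dDissection m T ∧
      Even (ThreeD.index n S + ThreeD.index m T) := by
    rcases h with ⟨⟨hS, h1⟩, hT, h2⟩ | ⟨⟨hS, h1⟩, hT, h2⟩
    · exact ⟨hS, hT, h1.add h2⟩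
    · exact ⟨hS, hT, h1.add_odd h2⟩
  refine ⟨fun k hk => ?_, ThreeD.injOn_circSeq hS.1 hT.1, ThreeD.injOn_bulletSeq hS.1 hT.1⟩
  rw [Finset.mem_Icc] at hk
  rw [ThreeD.circ_eq_glue, ThreeD.circSeq_eq_glueSeq, ThreeD.bullet_eq_glue,
    ThreeD.bulletSeq_eq_glueSeq]
  exact ⟨(ThreeD.isGluing_circ hS.1.three_le hT.1.three_le hk.1 hk.2).solution_glue hS hT heven,
    (ThreeD.isGluing_bullet hS.1.three_le hT.1.three_le hk.1 hk.2).solution_glue hS hT heven⟩
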